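/- Let $k=\mathbb F_q$ be a finite field of characteristic $p$ and let $X_{-1},X_0$ be smooth projective absolutely irreducible curves over $k$ with function fields $K,L$. Points are closed points. **Differential equations.** A rank two differential equation on a curve with function field $F$ is a triple $(M,\nabla,e)$: a two-dimensional $F$-vector space $M$, a $k$-connection $\nabla:M\to\Omega^1_{F/k}\otimes_F M$, and a cyclic vector $e$ (for some nonzero derivation $D$ of $F/k$ the vectors $e,\nabla(D)e$ span $M$). At a point $P$ with local parameter $t$ write $\nabla(\tfrac{d}{dt})^2e=-a_2e-a_1\nabla(\tfrac{d}{dt})e$; the equation is $y''+a_1y'+a_2y=0$. The point $P$ is *singular* if $a_1$ or $a_2$ has a pole at $P$; the equation is *Fuchsian* if at each singular point $a_i$ has a pole of order at most $i$ ($i=1,2$). Then, with $a_i=c_it^{-i}+\cdots$, the local exponents at $P$ are the roots of $X^2+(c_1-1)X+c_2$. An element $u\in F$ is an *algebraic solution* if $u=\sigma(e)$ for a horizontal section $\sigma$ of the dual $M^*$ (equivalently $u''+a_1u'+a_2u=0$). Two equations $(M_1,\nabla_1,e_1)$, $(M_2,\nabla_2,e_2)$ are *equivalent* if there is a rank one module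 $(N,\nabla_N)$ with basis vector $n$, $\nabla_N n=\omega\otimes n$, such that $(M_1,\nabla_1)\otimes (N,\nabla_N)\cong (M_2,\nabla_2)$ by an isomorphism with $e_1\otimes n\mapsto e_2$, such that $d\theta=\theta\omega$ for some $\theta\in F^\times$, and such that all poles of $\omega$ are singular points of $(M_1,\nabla_1,e_1)$. The pull back under a cover $f$ given by a field embedding $F\to F'$ is $F'\otimes_F M$ with the pull back connection and cyclic vector $1\otimes e$. **Setting.** Let $(M,\nabla,e)$ be a Fuchsian rank two differential equation on $X_{-1}$ with set of singular points $S$. Assume that it has a nonzero algebraic solution $\Phi\in K$ and that the two local exponents at some point of $S$ are equal. Let $g,h:X_0\rightrightarrows X_{-1}$ be separable tame covers over $k$, unbranched outside $S$, such that the pull backs of $(M,\nabla,e)$ under $g$ and $h$ are equivalent. Let $\mathfrak S$ be the set of singular points of the pull back under $g$. For $m\ge 0$ let $X_m$ be the normalization of $$X_m'=\{(x_0,\dots,x_m)\in X_0^{m+1}\mid h(x_i)=g(x_{i-1}),\ 1\le i\le m\},$$ and let $\mathcal T_{g,h}=(X_m)_{m\ge0}$. Assume (a) $\mathfrak S=g^{-1}(S)=h^{-1}(S)$;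 (b) all curves $X_m$ are absolutely irreducible; (c) $\deg g=\deg h=:\delta$. Put $\mathfrak T=\{x_0\in X_0\mid \operatorname{ord}_{x_0}(\Phi\circ g)\not\equiv0 \bmod p,\ x_0\notin\mathfrak S\}$. **Claim.** Suppose that all points of $\mathfrak T$ are $\mathbb F_q$-rational. Then every point of $\mathfrak T$ splits completely in the tower: for every $m$, every point of $X_m$ lying over it under $x_0:X_m\to X_0$ is unramified over $X_0$ and $\mathbb F_q$-rational. Moreover $\mathfrak T$ is finite, the limit $\nu_q(\mathcal T_{g,h})=\lim_{m\to\infty}N_q(X_m)/\delta^m$ exists, where $N_q(X_m)$ is the number of $\mathbb F_q$-rational points of $X_m$, and $$\nu_q(\mathcal T_{g,h})\ \ge\ \#\mathfrak T .$$ -/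

import Mathlib

open scoped TensorProduct WithZero
open KaehlerDifferential

noncomputable section

namespace SplittingTower

universe u v w x

/-! ### Curves, places and covers in terms of function fields -/

/-- A commutative `k`-algebra is geometrically integral: its base change to an algebraic closure of
`k` is a domain. A curve is absolutely irreducible iff its ring of rational functions is
geometrically integral. -/
def GeomIntegral (k : Type u) (R : Type v) [Field k] [CommRing R] [Algebra k R] : Prop :=
  IsDomain (AlgebraicClosure k ⊗[k] R)

/-- `F` is the function field of a (smooth projective) absolutely irreducible curve over `k`:
a finite extension of a rational function field `k(x)`, geometrically integral over `k`. -/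
structure IsCurve (k : Type u) (F : Type v) [Field k] [Field F] [Algebra k F] : Prop where
  exists_finite : ∃ t : F, Transcendental k t ∧ FiniteDimensional (IntermediateField.adjoin k {t}) F
  geomIntegral : GeomIntegral k F

/-- A place of `F / k`, i.e. a closed point of the smooth projective curve with function field `F`:
a normalized (surjective) discrete valuation of `F`, trivial on `k`, written multiplicatively.
It is used only for `F` a field. -/
structure Place (k : Type u) (F : Type v) [Field k] [CommRing F] [Algebra k F] where
  val : Valuation F ℤᵐ⁰
  surjective : Function.Surjective val
  map_const : ∀ c : k, c ≠ 0 → val (algebraMap k F c) = 1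

namespace Place

variable {k : Type u} {F : Type v} {K : Type v} {L : Type w}
variable [Field k] [CommRing F] [Algebra k F] [CommRing K] [Algebra k K] [CommRing L] [Algebra k L]

/-- The order of vanishing of `f` at `P` (for `f ≠ 0`). -/
def ord (P : Place k F) (f : F) : ℤ := -WithZero.log (P.val f)

/-- `t` is a local parameter at `P`. -/
def IsLocalParameter (P : Place k F) (t : F) : Prop := P.val t = WithZero.exp (-1 : ℤ)

/-- `P` is a `k`-rational point: the residue field of `P` is `k`. -/
def IsRational (P : Place k F) : Prop :=
  ∀ f : F, P.val f ≤ 1 → ∃ c : k, P.val (f - algebraMap k F c) < 1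

/-- For an embedding `g : K → L` of function fields (a cover of curves), the place `Q` of `L` lies
over the place `P` of `K` with ramification index `n`. -/
def HasRamificationIdx (g : K →ₐ[k] L) (P : Place k K) (Q : Place k L) (n : ℕ) : Prop :=
  ∀ f : K, Q.val (g f) = P.val f ^ n

/-- `Q` is mapped to `P` by the cover given by `g`. -/
def LiesOver (g : K →ₐ[k] L) (P : Place k K) (Q : Place k L) : Prop :=
  ∃ n : ℕ, HasRamificationIdx g P Q n

/-- The inverse image of a set of points under the cover given by `g`. -/
def preimage (g : K →ₐ[k] L) (S : Set (Place k K)) : Set (Place k L) :=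
  {Q | ∃ P ∈ S, LiesOver g P Q}

end Place

/-- The number of `k`-rational points of the curve with function field `F`. -/
def numRationalPoints (k : Type u) (F : Type v) [Field k] [CommRing F] [Algebra k F] : ℕ :=
  Nat.card {P : Place k F // P.IsRational}

section Covers

variable {k : Type u} {K : Type v} {L : Type w} [Field k] [Field K] [Algebra k K] [Field L]
  [Algebra k L]

/-- The degree of a cover. -/
def coverDegree (g : K →ₐ[k] L) : ℕ := Module.finrank g.fieldRange L

/-- The cover is separable. -/
def IsSeparableCover (g : K →ₐ[k] L) : Prop := Algebra.IsSeparable g.fieldRange L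

/-- The cover is tame: no ramification index is divisible by the characteristic `p`. (The constant
field is finite below, so residue extensions are separable.) -/
def IsTameCover (p : ℕ) (g : K →ₐ[k] L) : Prop :=
  ∀ (P : Place k K) (Q : Place k L) (n : ℕ), Place.HasRamificationIdx g P Q n → ¬ p ∣ n

/-- The cover is unbranched outside `S`. -/
def IsUnbranchedOutside (g : K →ₐ[k] L) (S : Set (Place k K)) : Prop :=
  ∀ (P : Place k K) (Q : Place k L) (n : ℕ), Place.HasRamificationIdx g P Q n → P ∉ S → n = 1

end Covers

/-! ### The tower -/

/-- A commutative `k`-algebra with two embeddings of `L`; it stands for the ring of rational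
functions of the fibre product `X_m'`, with the coordinate functions `x_0` and `x_m`. -/
structure TowerStage (k : Type u) (L : Type w) [Field k] [Field L] [Algebra k L] where
  ring : Type w
  [commRing : CommRing ring]
  [algebra : Algebra k ring]
  first : L →ₐ[k] ring
  last : L →ₐ[k] ring

attribute [instance] TowerStage.commRing TowerStage.algebra

section Tower

variable {k : Type u} {K : Type v} {L : Type w} [Field k] [Field K] [Algebra k K] [Field L]
  [Algebra k L]

/-- The fibre product of `X_m' → X_{-1}` (the map `g ∘ x_m`) and `h : X_0 → X_{-1}`. -/
def TowerStage.next (g h : K →ₐ[k] L) (A : TowerStage k L) : TowerStage k L :=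
  letI : Algebra K A.ring := (A.last.comp g).toRingHom.toAlgebra
  letI : Algebra K L := h.toRingHom.toAlgebra
  haveI : IsScalarTower k K A.ring :=
    IsScalarTower.of_algebraMap_eq fun c => ((A.last.comp g).commutes c).symm
  haveI : IsScalarTower k K L := IsScalarTower.of_algebraMap_eq fun c => (h.commutes c).symm
  { ring := A.ring ⊗[K] L
    first := (Algebra.TensorProduct.includeLeft : A.ring →ₐ[k] A.ring ⊗[K] L).comp A.first
    last := (Algebra.TensorProduct.includeRight : L →ₐ[K] A.ring ⊗[K] L).restrictScalars k }

/-- The tower `T_{g,h}` : stage `m` is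
`X_m' = {(x_0, …, x_m) ∈ X_0^{m+1} | h(x_i) = g(x_{i-1})}`, given by its ring of rational functions
`L ⊗_K L ⊗_K ⋯ ⊗_K L` with `m + 1` factors. When this ring is geometrically integral, it is a field
(it is finite over `L`), namely the function field of the normalization `X_m` of `X_m'`. -/
def tower (g h : K →ₐ[k] L) : ℕ → TowerStage k L
  | 0 => { ring := L, first := AlgHom.id k L, last := AlgHom.id k L }
  | m + 1 => (tower g h m).next g h

end Tower

/-! ### Connections and differential equations -/

/-- A `k`-connection on the `K`-vector space `M`. -/
structure Connection (k : Type u) (K : Type v) (M : Type x) [Field k] [Field K] [Algebra k K]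
    [AddCommGroup M] [Module K M] where
  toFun : M →+ Ω[K⁄k] ⊗[K] M
  leibniz : ∀ (f : K) (m : M), toFun (f • m) = D k K f ⊗ₜ[K] m + f • toFun m

section Connection

variable {k : Type u} {K : Type v} {M : Type x} [Field k] [Field K] [Algebra k K]
  [AddCommGroup M] [Module K M]

/-- The action `∇(d)` on `M` of a derivation `d` of `K / k`. -/
def Connection.along (C : Connection k K M) (d : Derivation k K K) (m : M) : M :=
  TensorProduct.lid K M (LinearMap.rTensor M d.liftKaehlerDifferential (C.toFun m))

/-- A linear functional `σ` is horizontal for the dual connection: `σ(∇ m) = d(σ(m))`. -/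
def Connection.IsHorizontalDual (C : Connection k K M) (σ : Module.Dual K M) : Prop :=
  ∀ m : M, TensorProduct.rid K (Ω[K⁄k]) (LinearMap.lTensor (Ω[K⁄k]) σ (C.toFun m)) = D k K (σ m)

end Connection

section Pullback

variable (k : Type u) (K : Type v) (L : Type w) (M : Type x) [Field k] [Field K] [Algebra k K]
  [Field L] [Algebra k L] [Algebra K L] [IsScalarTower k K L] [AddCommGroup M] [Module K M]

/-- The map `ω ⊗ m ↦ f^*ω ⊗ (1 ⊗ m)`. -/
def pullbackForm : Ω[K⁄k] ⊗[K] M →+ Ω[L⁄k] ⊗[L] (L ⊗[K] M) :=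
  TensorProduct.liftAddHom
    (AddMonoidHom.mk' (fun ω : Ω[K⁄k] => AddMonoidHom.mk'
        (fun m : M => (KaehlerDifferential.map k k K L ω) ⊗ₜ[L] ((1 : L) ⊗ₜ[K] m))
        (fun m n => by rw [TensorProduct.tmul_add, TensorProduct.tmul_add]))
      (fun ω η => by
        ext m
        simp [TensorProduct.add_tmul]))
    (fun r ω m => by
      simp only [AddMonoidHom.mk'_apply, map_smul]
      rw [← algebraMap_smul L r (KaehlerDifferential.map k k K L ω), TensorProduct.smul_tmul,
        algebraMap_smul, TensorProduct.tmul_smul r (1 : L) m])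

variable {k K M}

theorem pullbackForm_tmul (ω : Ω[K⁄k]) (m : M) :
    pullbackForm k K L M (ω ⊗ₜ[K] m)
      = (KaehlerDifferential.map k k K L ω) ⊗ₜ[L] ((1 : L) ⊗ₜ[K] m) := rfl

theorem pullbackForm_smul (r : K) (z : Ω[K⁄k] ⊗[K] M) :
    pullbackForm k K L M (r • z) = algebraMap K L r • pullbackForm k K L M z := by
  induction z using TensorProduct.induction_on with
  | zero => simp
  | tmul ω m =>
    rw [TensorProduct.smul_tmul', pullbackForm_tmul, pullbackForm_tmul, map_smul,
      ← algebraMap_smul L r (KaehlerDifferential.map k k K L ω), TensorProduct.smul_tmul']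
  | add a b ha hb => rw [smul_add, map_add, map_add, ha, hb, smul_add]

/-- The additive map `a ⊗ m ↦ da ⊗ (1 ⊗ m) + a • f^*(∇ m)`. -/
def Connection.pullbackFun (C : Connection k K M) : L ⊗[K] M →+ Ω[L⁄k] ⊗[L] (L ⊗[K] M) :=
  TensorProduct.liftAddHom
    (AddMonoidHom.mk' (fun a : L => AddMonoidHom.mk'
        (fun m : M => D k L a ⊗ₜ[L] ((1 : L) ⊗ₜ[K] m) + a • pullbackForm k K L M (C.toFun m))
        (fun m n => by
          simp only [TensorProduct.tmul_add, map_add, smul_add]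
          abel))
      (fun a b => by
        ext m
        simp only [AddMonoidHom.mk'_apply, AddMonoidHom.add_apply, map_add,
          TensorProduct.add_tmul, add_smul]
        abel))
    (fun r a m => by
      simp only [AddMonoidHom.mk'_apply]
      rw [C.leibniz, map_add, pullbackForm_tmul, pullbackForm_smul, KaehlerDifferential.map_D,
        Algebra.smul_def, Derivation.leibniz, TensorProduct.add_tmul, smul_add, smul_smul,
        ← TensorProduct.smul_tmul', ← TensorProduct.smul_tmul', TensorProduct.tmul_smul r (1 : L) m,
        ← algebraMap_smul L r ((1 : L) ⊗ₜ[K] m), TensorProduct.tmul_smul,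
        mul_comm (algebraMap K L r) a]
      abel)

theorem Connection.pullbackFun_tmul (C : Connection k K M) (a : L) (m : M) :
    C.pullbackFun L (a ⊗ₜ[K] m)
      = D k L a ⊗ₜ[L] ((1 : L) ⊗ₜ[K] m) + a • pullbackForm k K L M (C.toFun m) := rfl

theorem Connection.pullbackFun_leibniz_tmul (C : Connection k K M) (f a : L) (m : M) :
    C.pullbackFun L (f • (a ⊗ₜ[K] m))
      = D k L f ⊗ₜ[L] (a ⊗ₜ[K] m) + f • C.pullbackFun L (a ⊗ₜ[K] m) := by
  have h1 : a ⊗ₜ[K] m = a • ((1 : L) ⊗ₜ[K] m) := by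
    rw [TensorProduct.smul_tmul', smul_eq_mul, mul_one]
  have h2 : D k L f ⊗ₜ[L] (a ⊗ₜ[K] m) = (a • D k L f) ⊗ₜ[L] ((1 : L) ⊗ₜ[K] m) := by
    rw [h1, TensorProduct.tmul_smul, TensorProduct.smul_tmul']
  rw [TensorProduct.smul_tmul', smul_eq_mul, C.pullbackFun_tmul L, C.pullbackFun_tmul L, h2,
    Derivation.leibniz, TensorProduct.add_tmul, smul_add, smul_smul, TensorProduct.smul_tmul']
  abel

/-- The pull back connection on `L ⊗_K M`: `∇_f(a ⊗ m) = da ⊗ (1 ⊗ m) + a • f^*(∇ m)`. -/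
def Connection.pullback (C : Connection k K M) : Connection k L (L ⊗[K] M) where
  toFun := C.pullbackFun L
  leibniz := by
    intro f z
    refine TensorProduct.induction_on z ?_ ?_ ?_
    · rw [smul_zero, map_zero, smul_zero, TensorProduct.tmul_zero, add_zero]
    · intro a m
      exact C.pullbackFun_leibniz_tmul L f a m
    · intro a b ha hb
      rw [smul_add, map_add, map_add, ha, hb, TensorProduct.tmul_add, smul_add]
      abel

end Pullback

/-- A linear differential equation on the curve with function field `K`: a `K`-vector space `M` with
a connection and a chosen vector `e` (required to be cyclic in `IsCyclicOfRankTwo`). -/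
structure DiffEq (k : Type u) (K : Type v) [Field k] [Field K] [Algebra k K] where
  M : Type x
  [addCommGroup : AddCommGroup M]
  [module : Module K M]
  conn : Connection k K M
  e : M

attribute [instance] DiffEq.addCommGroup DiffEq.module

namespace DiffEq

section Basic

variable {k : Type u} {K : Type v} [Field k] [Field K] [Algebra k K]

/-- `M` has dimension two and `e`, `∇(d)e` span `M` for some nonzero derivation `d`. -/
def IsCyclicOfRankTwo (E : DiffEq.{u, v, x} k K) : Prop :=
  Module.finrank K E.M = 2 ∧
    ∃ d : Derivation k K K, d ≠ 0 ∧ Submodule.span K {E.e, E.conn.along d E.e} = ⊤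

/-- `u ∈ K` is an algebraic solution: `u = σ(e)` for a horizontal section `σ` of the dual of `M`.
With `e₁ = e`, `e₂ = ∇(d)e` this says `σ = u e₁^* + u' e₂^*`, i.e. `u'' + a₁ u' + a₂ u = 0`. -/
def IsSolution (E : DiffEq.{u, v, x} k K) (f : K) : Prop :=
  ∃ σ : Module.Dual K E.M, E.conn.IsHorizontalDual σ ∧ σ E.e = f

/-- `t` is a local parameter at `P`, `d = d/dt`, and `y'' + a₁ y' + a₂ y = 0` is the differential
equation with respect to `d/dt`, i.e. `∇(d)² e = - a₂ e - a₁ ∇(d)e`. -/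
def IsLocalEquation (E : DiffEq.{u, v, x} k K) (P : Place k K) (t : K) (d : Derivation k K K)
    (a₁ a₂ : K) : Prop :=
  P.IsLocalParameter t ∧ d t = 1 ∧
    E.conn.along d (E.conn.along d E.e) = -(a₂ • E.e) - a₁ • E.conn.along d E.e

/-- `P` is a regular point: the coefficients `a₁`, `a₂` have no pole at `P`. -/
def IsRegularAt (E : DiffEq.{u, v, x} k K) (P : Place k K) : Prop :=
  ∃ (t : K) (d : Derivation k K K) (a₁ a₂ : K),
    E.IsLocalEquation P t d a₁ a₂ ∧ P.val a₁ ≤ 1 ∧ P.val a₂ ≤ 1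

/-- The set of singularities. -/
def sing (E : DiffEq.{u, v, x} k K) : Set (Place k K) := {P | ¬ E.IsRegularAt P}

/-- Every singularity is regular: `a_i` has a pole of order at most `i`. -/
def IsFuchsian (E : DiffEq.{u, v, x} k K) : Prop :=
  ∀ P ∈ E.sing, ∃ (t : K) (d : Derivation k K K) (a₁ a₂ : K),
    E.IsLocalEquation P t d a₁ a₂ ∧ P.val (t * a₁) ≤ 1 ∧ P.val (t ^ 2 * a₂) ≤ 1

/-- The two local exponents at `P` coincide: with `a_i = c_i t^{-i} + ⋯`, the indicial polynomial
`X² + (c₁ - 1) X + c₂` equals `(X - γ)²` over the (perfect) residue field. -/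
def HasEqualLocalExponents (E : DiffEq.{u, v, x} k K) (P : Place k K) : Prop :=
  ∃ (t : K) (d : Derivation k K K) (a₁ a₂ γ : K),
    E.IsLocalEquation P t d a₁ a₂ ∧ P.val (t * a₁) ≤ 1 ∧ P.val (t ^ 2 * a₂) ≤ 1 ∧
      P.val γ ≤ 1 ∧ P.val (t * a₁ - 1 + 2 * γ) < 1 ∧ P.val (t ^ 2 * a₂ - γ ^ 2) < 1

/-- The differential form `ω` has no pole at `P`: `ω = b dt` with `b` holomorphic. -/
def FormIsHolomorphicAt (ω : Ω[K⁄k]) (P : Place k K) : Prop :=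
  ∃ t b : K, P.IsLocalParameter t ∧ P.val b ≤ 1 ∧ ω = b • D k K t

/-- Equivalence of differential equations: `E₂ ≅ E₁ ⊗ N` with `N` of rank one. Here `N = K` with
connection `∇(1) = ω ⊗ 1`, so that `E₁ ⊗ N` is `M₁` with connection `∇₁ + ω`; the module `N` has a
nonzero algebraic solution `θ`, i.e. `dθ = θ ω`, and its singularities (the poles of `ω`) are
singularities of `E₁`. The isomorphism respects the cyclic vectors, so that `y ↦ θ y` turns the
differential equation of `E₁` into that of `E₂`. -/
def Equivalent (E₁ E₂ : DiffEq.{u, v, x} k K) : Prop :=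
  ∃ (ω : Ω[K⁄k]) (θ : K) (φ : E₁.M ≃ₗ[K] E₂.M),
    θ ≠ 0 ∧ D k K θ = θ • ω ∧
    (∀ P : Place k K, ¬ FormIsHolomorphicAt ω P → P ∈ E₁.sing) ∧
    φ E₁.e = E₂.e ∧
    ∀ m : E₁.M, E₂.conn.toFun (φ m)
      = LinearMap.lTensor (Ω[K⁄k]) φ.toLinearMap (E₁.conn.toFun m) + ω ⊗ₜ[K] φ m

end Basic

section Pull

variable {k : Type u} {K : Type v} {L : Type w} [Field k] [Field K] [Algebra k K] [Field L]
  [Algebra k L]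

/-- The pull back of a differential equation under the cover given by `g : K → L`: the pull back
connection on `L ⊗_K M` with cyclic vector `1 ⊗ e`. -/
def pullback (g : K →ₐ[k] L) (E : DiffEq.{u, v, x} k K) : DiffEq.{u, w, max w x} k L :=
  letI : Algebra K L := g.toRingHom.toAlgebra
  haveI : IsScalarTower k K L := IsScalarTower.of_algebraMap_eq fun c => (g.commutes c).symm
  { M := L ⊗[K] E.M
    conn := E.conn.pullback L
    e := (1 : L) ⊗ₜ[K] E.e }

/-- The pair of covers `(g, h)` is adapted to `E`. -/
def IsAdapted (g h : K →ₐ[k] L) (E : DiffEq.{u, v, x} k K) : Prop :=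
  (E.pullback g).Equivalent (E.pullback h)

/-- The set `𝔗` of points `x₀` of `X₀` outside the singularities of the pull back under `g` such
that `ord_{x₀}(Φ ∘ g)` is not divisible by `p`. -/
def splitSet (p : ℕ) (g : K →ₐ[k] L) (E : DiffEq.{u, v, x} k K) (Φ : K) : Set (Place k L) :=
  {Q | ¬ (p : ℤ) ∣ Q.ord (g Φ) ∧ Q ∉ (E.pullback g).sing}

end Pull

end DiffEq

end SplittingTower

end

/-!
Let `𝔗` be the set of points of the statement. The proof rests on the fact that `𝔗` is closed under
the correspondence `h⁻¹ ∘ g` and that `h` is unramified with rational fibres over `g(𝔗)`; the rest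
is a splitting and counting argument along the tower.

*Closedness of `𝔗`.* Away from the singularities both covers are unramified, so that the claim
amounts to `p ∣ ord_Q (Φ ∘ g) ↔ p ∣ ord_Q (Φ ∘ h)` at every regular point `Q` of the pull back
(`DiffEq.IsAdapted.dvd_ord_iff`). The equivalence of the two pull backs, given by `ω` and `θ` with
`dθ = θ ω`, makes `θ⁻¹ (Φ ∘ h)` a second solution of the pull back under `g`. At a point with equal
local exponents `γ`, every nonzero solution `y` satisfies `(t y' / y)(Q) = γ`, because the value is a
root of `(X - γ)²` (`Place.val_logDeriv_sub_lt_one`). Hence for solutions `y`, `z` all the nonzero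
functions `y / z - c ^ p` have order divisible by `p`, which forces `y / z` to be a `p`-th power
(`Place.exists_eq_pow_mul_of_equal_exponents`). The order of `θ` is divisible by `p` wherever
`ω = dθ / θ` is holomorphic. All local computations use that a local parameter `s` is a `p`-basis of
the function field: `f = ∑ c_j ^ p s ^ j` with `0 ≤ j < p`, where the orders of the terms are
distinct modulo `p` (`Place.exists_eq_sum_pow`, `Place.val_derivation`). No completions are needed.

*Splitting.* A point `P` of `g(𝔗)` splits completely under `h`. By the fundamental identity
`∑ e f = n`, applied to the integral closure of the valuation ring of `P`, there are `[L : K]` points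
over `P`, and the Chinese remainder theorem gives a basis of `L / K` consisting of orthogonal
idempotents modulo the maximal ideal at `P` (`Place.SplitsCompletely.exists_basis`). Such a basis
survives base change and shows that each rational point over `P` splits completely in the next step
of the tower (`Place.hasRamificationIdx_one_of_approx_idempotents`,
`Place.SplitsCompletely.of_liesOver`). Induction along the tower (`tower_spec`) gives complete
splitting over `𝔗`, and exactly `δ ^ m #𝔗` points of the stage `m` over `𝔗`.

*The limit.* A curve over a finite field has finitely many rational points
(`IsCurve.finite_rational`), and a point has at most `δ` points above it in the next stage. So
`N_q(X_m) / δ ^ m` is decreasing, and it is bounded below by `#𝔗`.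
-/

noncomputable section

namespace SplittingTower

universe u v w x

/-! ### Places -/

namespace Place

variable {k : Type u} {F : Type v} {F' : Type w} [Field k] [Field F] [Algebra k F] [Field F']
  [Algebra k F']

theorem ext_val {P Q : Place k F} (h : ∀ x, P.val x = Q.val x) : P = Q := by
  cases P; cases Q
  congr
  exact Valuation.ext h

theorem exists_isLocalParameter (P : Place k F) : ∃ t, P.IsLocalParameter t := P.surjective _

theorem IsLocalParameter.ne_zero {P : Place k F} {t : F} (ht : P.IsLocalParameter t) : t ≠ 0 := by
  rintro rfl
  rw [IsLocalParameter, map_zero] at ht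
  exact WithZero.exp_ne_zero ht.symm

theorem val_eq_exp {P : Place k F} {f : F} (hf : f ≠ 0) : P.val f = WithZero.exp (-P.ord f) := by
  rw [ord, neg_neg, WithZero.exp_log]
  simpa using hf

theorem ord_eq_iff {P : Place k F} {f : F} (hf : f ≠ 0) {n : ℤ} :
    P.ord f = n ↔ P.val f = WithZero.exp (-n) := by
  rw [val_eq_exp hf, WithZero.exp_inj, neg_inj]

theorem IsLocalParameter.ord {P : Place k F} {t : F} (ht : P.IsLocalParameter t) :
    P.ord t = 1 := by
  rw [ord_eq_iff ht.ne_zero]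
  exact ht

theorem ord_mul (P : Place k F) {f g : F} (hf : f ≠ 0) (hg : g ≠ 0) :
    P.ord (f * g) = P.ord f + P.ord g := by
  rw [ord_eq_iff (mul_ne_zero hf hg), map_mul, val_eq_exp hf, val_eq_exp hg, ← WithZero.exp_add]
  congr 1
  ring

theorem ord_pow (P : Place k F) {f : F} (hf : f ≠ 0) (n : ℕ) :
    P.ord (f ^ n) = n * P.ord f := by
  rw [ord_eq_iff (pow_ne_zero n hf), map_pow, val_eq_exp hf, ← WithZero.exp_nsmul]
  simp

theorem val_const_le (P : Place k F) (c : k) : P.val (algebraMap k F c) ≤ 1 := by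
  rcases eq_or_ne c 0 with rfl | hc
  · simp
  · rw [P.map_const c hc]

/-- A place is determined by its valuation ring; it suffices to have one inclusion. -/
theorem eq_of_le_one {P Q : Place k F} (h : ∀ x, P.val x ≤ 1 → Q.val x ≤ 1) : P = Q := by
  have h1 : ∀ x, P.val x = 1 → Q.val x = 1 := fun x hx => by
    refine le_antisymm (h x hx.le) ?_
    have := h x⁻¹ (by simp [hx])
    rw [map_inv₀] at this
    have h0 : Q.val x ≠ 0 := by
      rw [Valuation.ne_zero_iff]
      rintro rfl
      simp at hx
    exact (inv_le_one₀ (zero_lt_iff.2 h0)).1 this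
  obtain ⟨t, ht⟩ := P.exists_isLocalParameter
  have ht0 := ht.ne_zero
  have key : ∀ x, x ≠ 0 → Q.val x = Q.val t ^ P.ord x := fun x hx => by
    have : P.val (x * t ^ (-P.ord x)) = 1 := by
      rw [map_mul, map_zpow₀, ht, val_eq_exp hx, ← WithZero.exp_zsmul, ← WithZero.exp_add]
      simp
    have := h1 _ this
    rw [map_mul, map_zpow₀, zpow_neg] at this
    have ht1 : Q.val t ^ P.ord x ≠ 0 := zpow_ne_zero _ (by simpa using ht0)
    field_simp at this
    exact this
  have hQt : Q.val t = WithZero.exp (-1 : ℤ) := by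
    obtain ⟨s, hs⟩ := Q.exists_isLocalParameter
    have hs0 := hs.ne_zero
    have e1 := key s hs0
    rw [hs, val_eq_exp ht0, ← WithZero.exp_zsmul, WithZero.exp_inj, smul_eq_mul] at e1
    have hle : Q.val t ≤ 1 := h t (by rw [ht]; exact WithZero.exp_le_exp.2 (by norm_num))
    rw [val_eq_exp ht0, ← WithZero.exp_zero, WithZero.exp_le_exp] at hle
    rw [val_eq_exp ht0, WithZero.exp_inj]
    have h2 : P.ord s * Q.ord t = 1 := by linarith
    have h3 := Int.eq_one_or_neg_one_of_mul_eq_one' h2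
    omega
  refine ext_val fun x => ?_
  rcases eq_or_ne x 0 with rfl | hx
  · simp
  · rw [key x hx, hQt, val_eq_exp hx, ← WithZero.exp_zsmul]
    simp

theorem HasRamificationIdx.ne_zero {g : F →ₐ[k] F'} {P : Place k F} {Q : Place k F'} {n : ℕ}
    (h : HasRamificationIdx g P Q n) : n ≠ 0 := by
  rintro rfl
  simpa using h 0

theorem HasRamificationIdx.val_le_one_iff {g : F →ₐ[k] F'} {P : Place k F} {Q : Place k F'} {n : ℕ}
    (h : HasRamificationIdx g P Q n) {f : F} : Q.val (g f) ≤ 1 ↔ P.val f ≤ 1 := by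
  rw [h, pow_le_one_iff h.ne_zero]

theorem HasRamificationIdx.val_lt_one_iff {g : F →ₐ[k] F'} {P : Place k F} {Q : Place k F'} {n : ℕ}
    (h : HasRamificationIdx g P Q n) {f : F} : Q.val (g f) < 1 ↔ P.val f < 1 := by
  rw [h, pow_lt_one_iff h.ne_zero]

theorem HasRamificationIdx.ord_eq {g : F →ₐ[k] F'} {P : Place k F} {Q : Place k F'} {n : ℕ}
    (h : HasRamificationIdx g P Q n) {f : F} (hf : f ≠ 0) : Q.ord (g f) = n * P.ord f := by
  rw [ord_eq_iff (by simpa using hf), h, val_eq_exp hf, ← WithZero.exp_nsmul]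
  simp

/-- The point below a given point is unique. -/
theorem LiesOver.unique {g : F →ₐ[k] F'} {P P' : Place k F} {Q : Place k F'}
    (h : LiesOver g P Q) (h' : LiesOver g P' Q) : P = P' := by
  obtain ⟨n, h⟩ := h
  obtain ⟨n', h'⟩ := h'
  exact eq_of_le_one fun x hx => h'.val_le_one_iff.1 (h.val_le_one_iff.2 hx)

/-- A valuation with values in `ℤᵐ⁰` that is nontrivial and trivial on the constants is a power
of a place. -/
theorem exists_val_eq_pow (v : Valuation F ℤᵐ⁰) (hv : ∀ c : k, c ≠ 0 → v (algebraMap k F c) = 1)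
    (hnt : ∃ f, f ≠ 0 ∧ v f ≠ 1) : ∃ (P : Place k F) (n : ℕ), ∀ f, v f = P.val f ^ n := by
  -- the value group is `n ℤ` with `n > 0`
  let H : AddSubgroup ℤ :=
    { carrier := {a | ∃ f, v f = WithZero.exp a}
      zero_mem' := ⟨1, by simp⟩
      add_mem' := by
        rintro a b ⟨f, hf⟩ ⟨g, hg⟩
        exact ⟨f * g, by rw [map_mul, hf, hg, WithZero.exp_add]⟩
      neg_mem' := by
        rintro a ⟨f, hf⟩
        exact ⟨f⁻¹, by rw [map_inv₀, hf, WithZero.exp_neg]⟩ }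
  obtain ⟨a, ha⟩ := Int.subgroup_cyclic H
  have hval : ∀ f, f ≠ 0 → v f = WithZero.exp (WithZero.log (v f)) := fun f hf => by
    rw [WithZero.exp_log (by simpa using hf)]
  have hmem : ∀ f, f ≠ 0 → a ∣ WithZero.log (v f) := fun f hf => by
    have : WithZero.log (v f) ∈ H := ⟨f, hval f hf⟩
    rw [ha, AddSubgroup.mem_closure_singleton] at this
    obtain ⟨m, hm⟩ := this
    exact ⟨m, by rw [← hm]; simp [mul_comm]⟩
  have ha0 : a ≠ 0 := by
    rintro rfl
    obtain ⟨f, hf, hf1⟩ := hnt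
    have := hmem f hf
    rw [zero_dvd_iff] at this
    apply hf1
    rw [hval f hf, this, WithZero.exp_zero]
  set n := a.natAbs with hn
  have hn0 : (n : ℤ) ≠ 0 := by simpa [hn] using ha0
  have hnpos : (0 : ℤ) < n := by positivity
  have hmem' : ∀ f, f ≠ 0 → ∃ m : ℤ, v f = WithZero.exp (n * m) := fun f hf => by
    obtain ⟨m, hm⟩ := (Int.natAbs_dvd).2 (hmem f hf)
    exact ⟨m, by rw [hval f hf, hm]⟩
  obtain ⟨s, hs⟩ : ∃ s, v s = WithZero.exp (n : ℤ) := by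
    have : (n : ℤ) ∈ H := by
      rw [ha, AddSubgroup.mem_closure_singleton]
      rcases Int.natAbs_eq a with h | h
      · exact ⟨1, by simp; omega⟩
      · exact ⟨-1, by simp; omega⟩
    exact this
  choose! m hm using hmem'
  classical
  let P : Place k F :=
    { val :=
        { toFun := fun f => if f = 0 then 0 else WithZero.exp (m f)
          map_zero' := by simp
          map_one' := by
            have h := hm 1 one_ne_zero
            rw [map_one, ← WithZero.exp_zero, WithZero.exp_inj] at h
            have : m 1 = 0 := by
              rcases mul_eq_zero.1 h.symm with h | h
              · exact absurd h hn0
              · exact h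
            simp [this]
          map_mul' := fun f g => by
            by_cases hf : f = 0
            · simp [hf]
            by_cases hg : g = 0
            · simp [hg]
            have h := hm (f * g) (mul_ne_zero hf hg)
            rw [map_mul, hm f hf, hm g hg, ← WithZero.exp_add, WithZero.exp_inj, ← mul_add] at h
            simp only [hf, hg, mul_eq_zero, or_self, if_false]
            rw [← mul_left_cancel₀ hn0 h, WithZero.exp_add]
          map_add_le_max' := fun f g => by
            by_cases hf : f = 0
            · simp [hf]
            by_cases hg : g = 0
            · simp [hg]
            by_cases hfg : f + g = 0
            · simp [hfg]
            have h := v.map_add f g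
            rw [hm f hf, hm g hg, hm _ hfg, le_max_iff, WithZero.exp_le_exp,
              WithZero.exp_le_exp, mul_le_mul_iff_right₀ hnpos, mul_le_mul_iff_right₀ hnpos] at h
            simpa only [hf, hg, hfg, if_false, le_max_iff, WithZero.exp_le_exp] using h }
      surjective := fun b => by
        rcases eq_or_ne b 0 with rfl | hb
        · exact ⟨0, map_zero _⟩
        have hs0 : s ≠ 0 := by
          rintro rfl
          rw [map_zero] at hs
          exact WithZero.exp_ne_zero hs.symm
        refine ⟨s ^ WithZero.log b, ?_⟩
        have h := hm (s ^ WithZero.log b) (zpow_ne_zero _ hs0)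
        rw [map_zpow₀, hs, ← WithZero.exp_zsmul, WithZero.exp_inj, smul_eq_mul, mul_comm] at h
        change (if s ^ WithZero.log b = 0 then 0 else WithZero.exp (m (s ^ WithZero.log b))) = b
        rw [if_neg (zpow_ne_zero _ hs0), ← mul_left_cancel₀ hn0 h, WithZero.exp_log hb]
      map_const := fun c hc => by
        have hc' : algebraMap k F c ≠ 0 := by simpa using hc
        have h := hm _ hc'
        rw [hv c hc, ← WithZero.exp_zero, WithZero.exp_inj] at h
        change (if algebraMap k F c = 0 then 0 else WithZero.exp (m (algebraMap k F c))) = 1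
        rw [if_neg hc']
        rcases mul_eq_zero.1 h.symm with h | h
        · exact absurd h hn0
        · rw [h, WithZero.exp_zero] }
  refine ⟨P, n, fun f => ?_⟩
  change v f = (if f = 0 then 0 else WithZero.exp (m f)) ^ n
  split_ifs with hf
  · have : n ≠ 0 := by exact_mod_cast hn0
    simp [hf, this]
  · rw [hm f hf, ← WithZero.exp_nsmul]
    simp

theorem exists_liesOver_of_nontrivial (g : F →ₐ[k] F') (Q : Place k F')
    (h : ∃ f, f ≠ 0 ∧ Q.val (g f) ≠ 1) : ∃ P, LiesOver g P Q :=
  exists_val_eq_pow (Q.val.comap g.toRingHom)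
    (fun c hc => by simpa using Q.map_const c hc) h

theorem exists_liesOver_of_liesOver_comp {E : Type x} [Field E] [Algebra k E] (g : F →ₐ[k] F')
    (i : E →ₐ[k] F) {P : Place k E} {Q : Place k F'} (h : LiesOver (g.comp i) P Q) :
    ∃ P', LiesOver g P' Q ∧ LiesOver i P P' := by
  obtain ⟨n, h⟩ := h
  obtain ⟨t, ht⟩ := P.exists_isLocalParameter
  have h1 : Q.val (g (i t)) < 1 := by
    have := h.val_lt_one_iff (f := t)
    refine this.2 ?_
    rw [ht, ← WithZero.exp_zero]
    exact WithZero.exp_lt_exp.2 (by norm_num)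
  obtain ⟨P', hP'⟩ := exists_liesOver_of_nontrivial g Q
    ⟨i t, by simpa using ht.ne_zero, h1.ne⟩
  refine ⟨P', hP', ?_⟩
  obtain ⟨n', hP'⟩ := hP'
  obtain ⟨P'', hP''⟩ := exists_liesOver_of_nontrivial i P'
    ⟨t, ht.ne_zero, (hP'.val_lt_one_iff.1 h1).ne⟩
  have : P'' = P := by
    obtain ⟨n'', hP''⟩ := hP''
    exact eq_of_le_one fun x hx => h.val_le_one_iff.1
      (hP'.val_le_one_iff.2 (hP''.val_le_one_iff.2 hx))
  exact this ▸ hP''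

theorem val_le_one_of_isIntegral {A : Type*} [CommRing A] [Algebra A F] (Q : Place k F)
    (h : ∀ a : A, Q.val (algebraMap A F a) ≤ 1) {y : F} (hy : IsIntegral A y) : Q.val y ≤ 1 := by
  have : y ∈ Q.val.integer := by
    have hint := hy
    let φ : A →+* Q.val.integer := (algebraMap A F).codRestrict _ h
    have h2 : IsIntegral Q.val.integer y := by
      obtain ⟨q, hq, hq'⟩ := hy
      refine ⟨q.map φ, hq.map φ, ?_⟩
      rw [Polynomial.eval₂_map]
      exact hq'
    obtain ⟨z, hz⟩ := (IsIntegrallyClosedIn.isIntegral_iff (R := Q.val.integer) (A := F)).1 h2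
    rw [← hz]
    exact z.2
  exact this

/-- In an algebraic extension every place of the upper field lies over a place of the lower field. -/
theorem exists_liesOver_of_isIntegral [Algebra F F'] [IsScalarTower k F F']
    [Algebra.IsIntegral F F'] (Q : Place k F') :
    ∃ P, LiesOver (IsScalarTower.toAlgHom k F F') P Q := by
  apply exists_liesOver_of_nontrivial
  by_contra! hcon
  obtain ⟨t, ht⟩ := Q.exists_isLocalParameter
  have := val_le_one_of_isIntegral Q (A := F) (fun a => by
    rcases eq_or_ne a 0 with rfl | ha
    · simp
    · exact (hcon a ha).le) (Algebra.IsIntegral.isIntegral t⁻¹)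
  rw [map_inv₀, ht, ← WithZero.exp_neg, ← WithZero.exp_zero, WithZero.exp_le_exp] at this
  norm_num at this

end Place

/-! ### Local parameters as `p`-bases, and orders of derivatives -/

section PBasis

variable {k : Type u} {L : Type w} [Field k] [Field L] [Algebra k L]

theorem IsCurve.essFiniteType (hL : IsCurve k L) : Algebra.EssFiniteType k L := by
  obtain ⟨t, -, hfin⟩ := hL.exists_finite
  have : Algebra.EssFiniteType k (IntermediateField.adjoin k {t}) :=
    IntermediateField.essFiniteType_iff.2 ⟨{t}, by simp⟩
  exact Algebra.EssFiniteType.comp k (IntermediateField.adjoin k {t}) L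

/-- Over a perfect field of constants the function field of a curve is a finite separable
extension of a rational function field. -/
theorem IsCurve.exists_separating [PerfectField k] (hL : IsCurve k L) :
    ∃ x : L, Transcendental k x ∧ FiniteDimensional (IntermediateField.adjoin k {x}) L ∧
      Algebra.IsSeparable (IntermediateField.adjoin k {x}) L := by
  obtain ⟨t, ht, hfin⟩ := hL.exists_finite
  have := hL.essFiniteType
  obtain ⟨s, hs, hsep⟩ := exists_isTranscendenceBasis_and_isSeparable_of_perfectField k L
  have htb : IsTranscendenceBasis k ((↑) : ({t} : Set L) → L) := by
    have hi : AlgebraicIndependent k ((↑) : ({t} : Set L) → L) :=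
      (algebraicIndependent_singleton_iff (⟨t, rfl⟩ : ({t} : Set L))).2 ht
    rw [hi.isTranscendenceBasis_iff_isAlgebraic]
    rw [Subtype.range_coe]
    have := hfin
    rw [← IntermediateField.isAlgebraic_adjoin_iff_top]
    infer_instance
  have hcard : s.card = 1 := by
    have := hs.lift_cardinalMk_eq htb
    simpa using this
  obtain ⟨x, rfl⟩ := Finset.card_eq_one.1 hcard
  rw [Finset.coe_singleton] at hsep
  refine ⟨x, ?_, ?_, hsep⟩
  · exact (algebraicIndependent_singleton_iff (⟨x, by simp⟩ : ({x} : Finset L))).1 hs.1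
  · have : Algebra.EssFiniteType (IntermediateField.adjoin k {x}) L :=
      Algebra.EssFiniteType.of_comp k _ L
    have : Algebra.FormallyUnramified (IntermediateField.adjoin k {x}) L :=
      Algebra.FormallyUnramified.of_isSeparable _ _
    exact Algebra.FormallyUnramified.finite_of_free _ _

/-- A function field of one variable over a perfect field of characteristic `p` has degree at most
`p` over its subfield of `p`-th powers. -/
theorem IsCurve.finrank_frobenius_le [PerfectField k] (p : ℕ) [hp : Fact p.Prime] [CharP k p]
    [CharP L p] (hL : IsCurve k L) :
    FiniteDimensional (frobenius L p).fieldRange L ∧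
      Module.finrank (frobenius L p).fieldRange L ≤ p := by
  obtain ⟨x, -, hfin, hsep⟩ := hL.exists_separating
  have : ExpChar k p := .prime hp.out
  have : ExpChar (IntermediateField.adjoin k {x}) p := expChar_of_injective_algebraMap (algebraMap k _).injective p
  set N := (frobenius L p).fieldRange
  have htop : IntermediateField.adjoin N {x} = ⊤ := by
    set M := IntermediateField.adjoin N {x}
    have hN : ∀ y : L, y ^ p ∈ M := fun y => M.algebraMap_mem ⟨y ^ p, y, rfl⟩
    have hx : x ∈ M := IntermediateField.mem_adjoin_simple_self N x
    have h1 : ∀ z ∈ IntermediateField.adjoin k {x}, z ∈ M := by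
      intro z hz
      induction hz using IntermediateField.adjoin_induction with
      | mem y hy => rw [Set.mem_singleton_iff.1 hy]; exact hx
      | algebraMap c =>
        obtain ⟨b, rfl⟩ := surjective_frobenius k p c
        rw [frobenius_def, map_pow]
        exact hN _
      | add a b _ _ ha hb => exact add_mem ha hb
      | inv a _ ha => exact inv_mem ha
      | mul a b _ _ ha hb => exact mul_mem ha hb
    rw [eq_top_iff]
    rintro y -
    have hy : y ∈ IntermediateField.adjoin (IntermediateField.adjoin k {x}) {y ^ p} := by
      rw [← IntermediateField.adjoin_simple_eq_adjoin_pow_expChar_of_isSeparable' _ _ y p]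
      exact IntermediateField.mem_adjoin_simple_self _ y
    suffices h : ∀ z ∈ IntermediateField.adjoin (IntermediateField.adjoin k {x}) {y ^ p}, z ∈ M from
      h y hy
    intro z hz
    induction hz using IntermediateField.adjoin_induction with
    | mem z hz => rw [Set.mem_singleton_iff.1 hz]; exact hN y
    | algebraMap c => exact h1 _ c.2
    | add a b _ _ ha hb => exact add_mem ha hb
    | inv a _ ha => exact inv_mem ha
    | mul a b _ _ ha hb => exact mul_mem ha hb
  let a : N := ⟨x ^ p, x, rfl⟩
  have hroot : Polynomial.aeval x (Polynomial.X ^ p - Polynomial.C a) = 0 := by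
    simp only [map_sub, map_pow, Polynomial.aeval_X, Polynomial.aeval_C]
    exact sub_self _
  have hmonic : (Polynomial.X ^ p - Polynomial.C a).Monic :=
    Polynomial.monic_X_pow_sub_C _ hp.out.ne_zero
  have hint : IsIntegral N x := ⟨_, hmonic, hroot⟩
  have hfd := IntermediateField.adjoin.finiteDimensional hint
  have hdeg := IntermediateField.adjoin.finrank hint
  rw [htop] at hfd hdeg
  refine ⟨Module.Finite.equiv (IntermediateField.topEquiv (F := N) (E := L)).toLinearEquiv, ?_⟩
  rw [← IntermediateField.finrank_top', hdeg]
  refine (Polynomial.natDegree_le_of_dvd (minpoly.dvd N x hroot) hmonic.ne_zero).trans ?_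
  rw [Polynomial.natDegree_X_pow_sub_C]

namespace Place

/-- The terms of `∑ c_j^p s^j`, `0 ≤ j < p`, have distinct orders, as these are distinct
modulo `p`. -/
theorem exists_dominant_term {p : ℕ} (hp : 0 < p) {Q : Place k L} {s : L}
    (hs : Q.IsLocalParameter s) (c : ℕ → L) (hc : ∃ j < p, c j ≠ 0) :
    ∃ j₀ < p, c j₀ ≠ 0 ∧ ∀ j < p, j ≠ j₀ → Q.val (c j ^ p * s ^ j) < Q.val (c j₀ ^ p * s ^ j₀) := by
  have hval : ∀ j, c j ≠ 0 → Q.val (c j ^ p * s ^ j) = WithZero.exp (-(p * Q.ord (c j) + j)) := by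
    intro j hj
    rw [← ord_eq_iff (mul_ne_zero (pow_ne_zero _ hj) (pow_ne_zero _ hs.ne_zero)),
      ord_mul _ (pow_ne_zero _ hj) (pow_ne_zero _ hs.ne_zero), ord_pow _ hj, ord_pow _ hs.ne_zero,
      hs.ord, mul_one]
  obtain ⟨j₀, hj₀, hmax⟩ := Finset.exists_max_image (Finset.range p)
    (fun j => Q.val (c j ^ p * s ^ j)) ⟨0, by simpa using hp⟩
  rw [Finset.mem_range] at hj₀
  have hc₀ : c j₀ ≠ 0 := by
    intro h0
    obtain ⟨j, hj, hcj⟩ := hc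
    have := hmax j (by simpa using hj)
    simp only [h0, zero_pow hp.ne', zero_mul, map_zero, le_zero_iff] at this
    rw [Valuation.zero_iff] at this
    exact mul_ne_zero (pow_ne_zero _ hcj) (pow_ne_zero _ hs.ne_zero) this
  refine ⟨j₀, hj₀, hc₀, fun j hj hne => lt_of_le_of_ne (hmax j (by simpa using hj)) fun heq => ?_⟩
  have hcj : c j ≠ 0 := by
    intro h0
    rw [h0, zero_pow hp.ne', zero_mul, map_zero, eq_comm, Valuation.zero_iff] at heq
    exact mul_ne_zero (pow_ne_zero _ hc₀) (pow_ne_zero _ hs.ne_zero) heq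
  rw [hval j hcj, hval j₀ hc₀, WithZero.exp_inj, neg_inj] at heq
  apply hne
  have : (j : ℤ) % p = j₀ % p := by
    have h := congrArg (· % (p : ℤ)) heq
    simpa using h
  rw [Int.emod_eq_of_lt (by positivity) (by exact_mod_cast hj),
    Int.emod_eq_of_lt (by positivity) (by exact_mod_cast hj₀)] at this
  exact_mod_cast this

/-- The dominant term of an expansion `f = ∑ c_j^p s^j` computes the order of `f`. -/
theorem exists_dominant_index {p : ℕ} (hp : 0 < p) {Q : Place k L} {s : L}
    (hs : Q.IsLocalParameter s) (c : ℕ → L) {f : L} (hf : f ≠ 0)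
    (hfc : f = ∑ j ∈ Finset.range p, c j ^ p * s ^ j) :
    ∃ j₀ < p, (p : ℤ) ∣ Q.ord f - j₀ ∧ Q.val (c j₀ ^ p * s ^ j₀) = Q.val f ∧
      ∀ j < p, j ≠ j₀ → Q.val (c j ^ p * s ^ j) < Q.val f := by
  have hc : ∃ j < p, c j ≠ 0 := by
    by_contra! hcon
    apply hf
    rw [hfc]
    refine Finset.sum_eq_zero fun j hj => ?_
    rw [hcon j (by simpa using hj), zero_pow hp.ne', zero_mul]
  obtain ⟨j₀, hj₀, hc₀, hlt⟩ := exists_dominant_term hp hs c hc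
  have hne : c j₀ ^ p * s ^ j₀ ≠ 0 := mul_ne_zero (pow_ne_zero _ hc₀) (pow_ne_zero _ hs.ne_zero)
  have hvf : Q.val f = Q.val (c j₀ ^ p * s ^ j₀) := by
    rw [hfc, ← Finset.add_sum_erase _ _ (Finset.mem_range.2 hj₀)]
    refine Valuation.map_add_eq_of_lt_left _ ?_
    refine Valuation.map_sum_lt _ (by simpa using hne) fun j hj => ?_
    rw [Finset.mem_erase, Finset.mem_range] at hj
    exact hlt j hj.2 hj.1
  refine ⟨j₀, hj₀, ?_, hvf.symm, fun j hj hjne => hvf ▸ hlt j hj hjne⟩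
  have : Q.ord f = p * Q.ord (c j₀) + j₀ := by
    rw [ord, hvf, ← ord, ord_mul _ (pow_ne_zero _ hc₀) (pow_ne_zero _ hs.ne_zero), ord_pow _ hc₀,
      ord_pow _ hs.ne_zero, hs.ord, mul_one]
  exact ⟨Q.ord (c j₀), by rw [this]; ring⟩

/-- A local parameter `s` is a `p`-basis: every function is `∑_{j<p} c_j^p s^j`. -/
theorem exists_eq_sum_pow [PerfectField k] (p : ℕ) [hp : Fact p.Prime] [CharP k p]
    (hL : IsCurve k L) {Q : Place k L} {s : L} (hs : Q.IsLocalParameter s) (f : L) :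
    ∃ c : ℕ → L, f = ∑ j ∈ Finset.range p, c j ^ p * s ^ j := by
  have : CharP L p := charP_of_injective_algebraMap (algebraMap k L).injective p
  obtain ⟨hfin, hle⟩ := hL.finrank_frobenius_le p
  set N := (frobenius L p).fieldRange
  have hroot : ∀ a : N, ∃ c : L, c ^ p = a := fun a => a.2
  choose r hr using hroot
  let ext : (Fin p → N) → ℕ → L := fun g j => if h : j < p then r (g ⟨j, h⟩) else 0
  have hext : ∀ (g : Fin p → N), ∑ i, g i • s ^ (i : ℕ) =
      ∑ j ∈ Finset.range p, ext g j ^ p * s ^ j := by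
    intro g
    rw [Finset.sum_range]
    refine Finset.sum_congr rfl fun i _ => ?_
    simp only [ext, i.2, dite_true, hr]
    rfl
  have hli : LinearIndependent N (fun i : Fin p => s ^ (i : ℕ)) := by
    rw [Fintype.linearIndependent_iff]
    intro g hg i
    by_contra hgi
    rw [hext] at hg
    obtain ⟨j₀, hj₀, hc₀, hlt⟩ := exists_dominant_term hp.out.pos hs (ext g) ⟨i, i.2, by
      simp only [ext, i.2, dite_true]
      intro h0
      have h1 := hr (g i)
      rw [h0, zero_pow hp.out.ne_zero] at h1
      exact hgi (Subtype.ext h1.symm)⟩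
    have hne : ext g j₀ ^ p * s ^ j₀ ≠ 0 :=
      mul_ne_zero (pow_ne_zero _ hc₀) (pow_ne_zero _ hs.ne_zero)
    rw [← Finset.add_sum_erase _ _ (Finset.mem_range.2 hj₀)] at hg
    have h2 : Q.val (∑ j ∈ (Finset.range p).erase j₀, ext g j ^ p * s ^ j) <
        Q.val (ext g j₀ ^ p * s ^ j₀) := by
      refine Valuation.map_sum_lt _ (by simpa using hne) fun j hj => ?_
      rw [Finset.mem_erase, Finset.mem_range] at hj
      exact hlt j hj.2 hj.1
    have h3 := Valuation.map_add_eq_of_lt_left _ h2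
    rw [hg, map_zero, eq_comm, Valuation.zero_iff] at h3
    exact hne h3
  have hcard : Fintype.card (Fin p) = Module.finrank N L := by
    refine le_antisymm ?_ (by simpa using hle)
    exact hli.fintype_card_le_finrank
  have : Nonempty (Fin p) := ⟨⟨0, hp.out.pos⟩⟩
  let b := basisOfLinearIndependentOfCardEqFinrank hli hcard
  refine ⟨ext (b.repr f), ?_⟩
  rw [← hext]
  conv_lhs => rw [← b.sum_repr f]
  simp [b]

section Derivation

theorem _root_.Derivation.map_pow_char (p : ℕ) [CharP L p] (d : Derivation k L L) (c : L) :
    d (c ^ p) = 0 := by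
  rw [Derivation.leibniz_pow, ← Nat.cast_smul_eq_nsmul L, CharP.cast_eq_zero, zero_smul]

variable [PerfectField k] (p : ℕ) [hp : Fact p.Prime] [CharP k p]

/-- A derivation scaled by `s / d s`, for a local parameter `s` at `Q`, does not decrease orders at
`Q`. It preserves the order of `f` if `p ∤ ord f` and increases it if `p ∣ ord f`. -/
theorem val_derivation (hL : IsCurve k L) {Q : Place k L} {s : L} (hs : Q.IsLocalParameter s)
    (d : Derivation k L L) {f : L} (hf : f ≠ 0) :
    ∃ a : L, s * d f = d s * a ∧ (¬ (p : ℤ) ∣ Q.ord f → Q.val a = Q.val f) ∧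
      ((p : ℤ) ∣ Q.ord f → Q.val a < Q.val f) := by
  have : CharP L p := charP_of_injective_algebraMap (algebraMap k L).injective p
  obtain ⟨c, hc⟩ := exists_eq_sum_pow p hL hs f
  obtain ⟨j₀, hj₀, hdvd, heq, hlt⟩ := exists_dominant_index hp.out.pos hs c hf hc
  have hconst : ∀ j : ℕ, Q.val (j : L) ≤ 1 := fun j => by
    simpa using Q.val_const_le (j : k)
  have hterm : ∀ j < p, j ≠ j₀ → Q.val ((j : L) * (c j ^ p * s ^ j)) < Q.val f := fun j hj hne => by
    rw [map_mul]
    exact (mul_le_of_le_one_left' (hconst j)).trans_lt (hlt j hj hne)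
  have hvf : Q.val f ≠ 0 := by simpa using hf
  refine ⟨∑ j ∈ Finset.range p, (j : L) * (c j ^ p * s ^ j), ?_, fun h => ?_, fun h => ?_⟩
  · conv_lhs => rw [hc]
    rw [map_sum, Finset.mul_sum, Finset.mul_sum]
    refine Finset.sum_congr rfl fun j _ => ?_
    rw [Derivation.leibniz, Derivation.map_pow_char p, smul_zero, add_zero, Derivation.leibniz_pow]
    rcases j with _ | j
    · simp
    · simp only [smul_eq_mul, nsmul_eq_mul, Nat.add_sub_cancel]
      ring
  · have hj0 : ¬ p ∣ j₀ := fun h' => h ((dvd_sub_left (Int.natCast_dvd_natCast.2 h')).1 hdvd)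
    have hk0 : (j₀ : k) ≠ 0 := fun h' => hj0 ((CharP.cast_eq_zero_iff k p j₀).1 h')
    have hv1 : Q.val (j₀ : L) = 1 := by simpa using Q.map_const _ hk0
    rw [← Finset.add_sum_erase _ _ (Finset.mem_range.2 hj₀)]
    rw [Valuation.map_add_eq_of_lt_left, map_mul, hv1, one_mul, heq]
    rw [map_mul, hv1, one_mul, heq]
    refine Valuation.map_sum_lt _ hvf fun j hj => ?_
    rw [Finset.mem_erase, Finset.mem_range] at hj
    exact hterm j hj.2 hj.1
  · have hj0 : j₀ = 0 := by
      have h1 : (p : ℤ) ∣ j₀ := (dvd_sub_right h).1 hdvd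
      exact Nat.eq_zero_of_dvd_of_lt (Int.natCast_dvd_natCast.1 h1) hj₀
    refine Valuation.map_sum_lt _ hvf fun j hj => ?_
    rcases eq_or_ne j j₀ with rfl | hne
    · rw [hj0]
      simpa [zero_lt_iff] using hf
    · exact hterm j (Finset.mem_range.1 hj) hne

/-- A function all of whose translates by `p`-th powers have order divisible by `p` is itself a
`p`-th power. -/
theorem exists_eq_pow_of_forall_dvd_ord (hL : IsCurve k L) (Q : Place k L) (r : L)
    (h : ∀ c : L, r ≠ c ^ p → (p : ℤ) ∣ Q.ord (r - c ^ p)) : ∃ c, r = c ^ p := by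
  obtain ⟨s, hs⟩ := Q.exists_isLocalParameter
  obtain ⟨c, hc⟩ := exists_eq_sum_pow p hL hs r
  refine ⟨c 0, ?_⟩
  by_contra hne
  have hf : r - c 0 ^ p ≠ 0 := sub_ne_zero.2 hne
  let c' : ℕ → L := fun j => if j = 0 then 0 else c j
  have hc' : r - c 0 ^ p = ∑ j ∈ Finset.range p, c' j ^ p * s ^ j := by
    have h0 : 0 ∈ Finset.range p := Finset.mem_range.2 hp.out.pos
    rw [hc, ← Finset.add_sum_erase _ _ h0, ← Finset.add_sum_erase _ (fun j => c' j ^ p * s ^ j) h0]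
    simp only [pow_zero, mul_one, add_sub_cancel_left, c', if_true, zero_pow hp.out.ne_zero,
      zero_add]
    refine Finset.sum_congr rfl fun j hj => ?_
    rw [if_neg (Finset.ne_of_mem_erase hj)]
  obtain ⟨j₀, hj₀, hdvd, heq, -⟩ := exists_dominant_index hp.out.pos hs c' hf hc'
  have h1 : (p : ℤ) ∣ j₀ := (dvd_sub_right (h _ hne)).1 hdvd
  have hj0 := Nat.eq_zero_of_dvd_of_lt (Int.natCast_dvd_natCast.1 h1) hj₀
  rw [hj0] at heq
  simp only [c', if_true, zero_pow hp.out.ne_zero, zero_mul, map_zero] at heq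
  rw [eq_comm, Valuation.zero_iff] at heq
  exact hf heq

end Derivation

end Place

end PBasis

/-! ### Algebraic solutions of pulled back and equivalent differential equations -/

section Covers

variable {k : Type u} {K : Type v} {L : Type w} [Field k] [Field K] [Algebra k K]
  [Field L] [Algebra k L]

/-- A field is isomorphic to its image under an embedding. -/
def fieldRangeEquiv (g : K →ₐ[k] L) : K ≃+* g.fieldRange :=
  RingEquiv.ofBijective (g.toRingHom.codRestrict g.fieldRange fun x => ⟨x, rfl⟩)
    ⟨fun _ _ h => g.injective (congrArg Subtype.val h), fun ⟨_, z, hz⟩ => ⟨z, Subtype.ext hz⟩⟩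

theorem IsSeparableCover.algebra_isSeparable {g : K →ₐ[k] L} (h : IsSeparableCover g) :
    @Algebra.IsSeparable K L _ _ g.toRingHom.toAlgebra := by
  let _ : Algebra K L := g.toRingHom.toAlgebra
  have : Algebra.IsSeparable g.fieldRange L := h
  exact Algebra.IsSeparable.of_equiv_equiv (fieldRangeEquiv g).symm (RingEquiv.refl L) (by
    ext y
    obtain ⟨z, rfl⟩ := (fieldRangeEquiv g).surjective y
    change algebraMap K L ((fieldRangeEquiv g).symm _) = _
    rw [RingEquiv.symm_apply_apply]
    rfl)

theorem coverDegree_eq_finrank (g : K →ₐ[k] L) :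
    coverDegree g = @Module.finrank K L _ _ g.toRingHom.toAlgebra.toModule := by
  let _ : Algebra K L := g.toRingHom.toAlgebra
  exact Algebra.finrank_eq_of_equiv_equiv (fieldRangeEquiv g).symm (RingEquiv.refl L) (by
    ext y
    obtain ⟨z, rfl⟩ := (fieldRangeEquiv g).surjective y
    change algebraMap K L ((fieldRangeEquiv g).symm _) = _
    rw [RingEquiv.symm_apply_apply]
    rfl)

/-- A separable cover of curves is finite. -/
theorem IsSeparableCover.algebra_finite {g : K →ₐ[k] L} (h : IsSeparableCover g)
    (hL : IsCurve k L) : @Module.Finite K L _ _ g.toRingHom.toAlgebra.toModule := by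
  let _ : Algebra K L := g.toRingHom.toAlgebra
  have : IsScalarTower k K L := IsScalarTower.of_algebraMap_eq fun c => (g.commutes c).symm
  have : Algebra.IsSeparable K L := h.algebra_isSeparable
  have := hL.essFiniteType
  have : Algebra.EssFiniteType K L := Algebra.EssFiniteType.of_comp k K L
  have : Algebra.FormallyUnramified K L := Algebra.FormallyUnramified.of_isSeparable _ _
  exact Algebra.FormallyUnramified.finite_of_free _ _

end Covers

section Connections

variable {k : Type u} {K : Type v} {L : Type w} {M : Type x} [Field k] [Field K] [Algebra k K]
  [Field L] [Algebra k L] [AddCommGroup M] [Module K M]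

theorem Connection.IsHorizontalDual.map_along {C : Connection k K M} {σ : Module.Dual K M}
    (hσ : C.IsHorizontalDual σ) (d : Derivation k K K) (m : M) :
    σ (C.along d m) = d (σ m) := by
  have key : ∀ z : Ω[K⁄k] ⊗[K] M,
      σ (TensorProduct.lid K M (LinearMap.rTensor M d.liftKaehlerDifferential z)) =
        d.liftKaehlerDifferential
          (TensorProduct.rid K (Ω[K⁄k]) (LinearMap.lTensor (Ω[K⁄k]) σ z)) := by
    intro z
    induction z using TensorProduct.induction_on with
    | zero => simp
    | tmul ω m => simp [mul_comm]
    | add a b ha hb => simp only [map_add, ha, hb]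
  rw [Connection.along, key, hσ m, Derivation.liftKaehlerDifferential_comp_D]

section

variable [Algebra K L] [IsScalarTower k K L]

/-- The pull back of a linear functional `σ` on `M` to `L ⊗_K M`. -/
def pullbackDual (L : Type w) [Field L] [Algebra K L] (σ : Module.Dual K M) :
    Module.Dual L (L ⊗[K] M) :=
  LinearMap.liftBaseChange L ((Algebra.linearMap K L).comp σ)

theorem pullbackDual_tmul (σ : Module.Dual K M) (a : L) (m : M) :
    pullbackDual L σ (a ⊗ₜ m) = a * algebraMap K L (σ m) := by
  simp [pullbackDual]

theorem Connection.IsHorizontalDual.pullback {C : Connection k K M} {σ : Module.Dual K M}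
    (hσ : C.IsHorizontalDual σ) : (C.pullback L).IsHorizontalDual (pullbackDual L σ) := by
  have key : ∀ z : Ω[K⁄k] ⊗[K] M,
      TensorProduct.rid L (Ω[L⁄k]) (LinearMap.lTensor (Ω[L⁄k]) (pullbackDual L σ)
        (pullbackForm k K L M z)) =
        KaehlerDifferential.map k k K L
          (TensorProduct.rid K (Ω[K⁄k]) (LinearMap.lTensor (Ω[K⁄k]) σ z)) := by
    intro z
    induction z using TensorProduct.induction_on with
    | zero => simp
    | tmul ω m => simp [pullbackForm_tmul, pullbackDual_tmul]
    | add a b ha hb => simp only [map_add, ha, hb]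
  intro z
  induction z using TensorProduct.induction_on with
  | zero =>
    rw [show (C.pullback L).toFun 0 = 0 from map_zero _]
    simp
  | tmul a m =>
    change TensorProduct.rid L (Ω[L⁄k]) (LinearMap.lTensor (Ω[L⁄k]) (pullbackDual L σ)
      (C.pullbackFun L (a ⊗ₜ m))) = _
    rw [C.pullbackFun_tmul L, map_add, map_add, map_smul, map_smul, key, hσ m,
      KaehlerDifferential.map_D, pullbackDual_tmul, Derivation.leibniz]
    simp [pullbackDual_tmul, add_comm]
  | add a b ha hb =>
    rw [show (C.pullback L).toFun (a + b) = (C.pullback L).toFun a + (C.pullback L).toFun b from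
      map_add _ _ _]
    simp only [map_add, ha, hb]

theorem Connection.along_pullback (C : Connection k K M) {d : Derivation k K K}
    {d' : Derivation k L L} (hd : ∀ f, d' (algebraMap K L f) = algebraMap K L (d f)) (m : M) :
    (C.pullback L).along d' ((1 : L) ⊗ₜ[K] m) = (1 : L) ⊗ₜ[K] C.along d m := by
  have h1 : ∀ ω : Ω[K⁄k], d'.liftKaehlerDifferential (KaehlerDifferential.map k k K L ω) =
      algebraMap K L (d.liftKaehlerDifferential ω) := by
    intro ω
    have : ω ∈ Submodule.span K (Set.range (D k K)) := by
      rw [KaehlerDifferential.span_range_derivation]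
      trivial
    induction this using Submodule.span_induction with
    | mem y hy =>
      obtain ⟨f, rfl⟩ := hy
      rw [KaehlerDifferential.map_D, Derivation.liftKaehlerDifferential_comp_D,
        Derivation.liftKaehlerDifferential_comp_D, hd]
    | zero => simp
    | add a b _ _ ha hb => simp only [map_add, ha, hb]
    | smul c a _ ha =>
      rw [map_smul (KaehlerDifferential.map k k K L), ← algebraMap_smul L c, map_smul, ha, map_smul]
      simp
  have key : ∀ z : Ω[K⁄k] ⊗[K] M,
      TensorProduct.lid L (L ⊗[K] M) (LinearMap.rTensor (L ⊗[K] M) d'.liftKaehlerDifferential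
        (pullbackForm k K L M z)) =
        (1 : L) ⊗ₜ[K] TensorProduct.lid K M (LinearMap.rTensor M d.liftKaehlerDifferential z) := by
    intro z
    induction z using TensorProduct.induction_on with
    | zero => simp
    | tmul ω m =>
      simp only [pullbackForm_tmul, LinearMap.rTensor_tmul, TensorProduct.lid_tmul, h1,
        TensorProduct.tmul_smul, algebraMap_smul]
    | add a b ha hb => simp only [map_add, ha, hb, TensorProduct.tmul_add]
  change TensorProduct.lid L (L ⊗[K] M) (LinearMap.rTensor (L ⊗[K] M) d'.liftKaehlerDifferential
    (C.pullbackFun L (1 ⊗ₜ m))) = _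
  rw [C.pullbackFun_tmul L, Derivation.map_one_eq_zero, TensorProduct.zero_tmul, zero_add, one_smul,
    key, Connection.along]

/-- Derivations extend along separable extensions, as these are formally étale. -/
theorem exists_derivation_extension [Algebra.IsSeparable K L] (d : Derivation k K K) :
    ∃ d' : Derivation k L L, ∀ f, d' (algebraMap K L f) = algebraMap K L (d f) := by
  have : Algebra.FormallyEtale K L := Algebra.FormallyEtale.of_isSeparable K L
  let l : L ⊗[K] Ω[K⁄k] →ₗ[L] L :=
    LinearMap.liftBaseChange L ((Algebra.linearMap K L).comp d.liftKaehlerDifferential)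
  let e := KaehlerDifferential.tensorKaehlerEquivOfFormallyEtale k K L
  refine ⟨(l.comp e.symm.toLinearMap).compDer (D k L), fun f => ?_⟩
  change l (e.symm (D k L (algebraMap K L f))) = _
  rw [KaehlerDifferential.tensorKaehlerEquivOfFormallyEtale_symm_D_algebraMap]
  simp [l]

end

end Connections

namespace DiffEq

variable {k : Type u} {K : Type v} {L : Type w} [Field k] [Field K] [Algebra k K]
  [Field L] [Algebra k L]

theorem IsSolution.pullback {E : DiffEq.{u, v, x} k K} {f : K} (hf : E.IsSolution f)
    (g : K →ₐ[k] L) : (E.pullback g).IsSolution (g f) := by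
  let _ : Algebra K L := g.toRingHom.toAlgebra
  have : IsScalarTower k K L := IsScalarTower.of_algebraMap_eq fun c => (g.commutes c).symm
  obtain ⟨σ, hσ, rfl⟩ := hf
  refine ⟨pullbackDual L σ, hσ.pullback, ?_⟩
  change pullbackDual L σ ((1 : L) ⊗ₜ[K] E.e) = _
  rw [pullbackDual_tmul, one_mul]
  rfl

/-- An algebraic solution of the pull back satisfies the pulled back scalar equation. -/
theorem IsSolution.scalar_equation {E : DiffEq.{u, v, x} k K} {g : K →ₐ[k] L}
    {y : L} (hy : (E.pullback g).IsSolution y) {P : Place k K} {t : K} {d : Derivation k K K}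
    {a₁ a₂ : K} (hloc : E.IsLocalEquation P t d a₁ a₂) {d' : Derivation k L L}
    (hd : ∀ f, d' (g f) = g (d f)) : d' (d' y) = -(g a₂ * y) - g a₁ * d' y := by
  let _ : Algebra K L := g.toRingHom.toAlgebra
  have : IsScalarTower k K L := IsScalarTower.of_algebraMap_eq fun c => (g.commutes c).symm
  obtain ⟨σ, hσ, he⟩ := hy
  change Module.Dual L (L ⊗[K] E.M) at σ
  change (E.conn.pullback L).IsHorizontalDual σ at hσ
  change σ ((1 : L) ⊗ₜ[K] E.e) = y at he
  rw [← he]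
  have h1 : ∀ m : E.M, d' (σ ((1 : L) ⊗ₜ[K] m)) = σ ((1 : L) ⊗ₜ[K] E.conn.along d m) := fun m => by
    rw [← hσ.map_along, E.conn.along_pullback hd]
  rw [h1, h1, hloc.2.2, TensorProduct.tmul_sub, TensorProduct.tmul_neg, TensorProduct.tmul_smul,
    TensorProduct.tmul_smul, ← algebraMap_smul L a₂, ← algebraMap_smul L a₁, map_sub, map_neg,
    map_smul, map_smul]
  rfl

/-- If `y` solves `E₂ ≅ E₁ ⊗ N`, then `θ⁻¹ y` solves `E₁`. -/
theorem isSolution_inv_mul {E₁ E₂ : DiffEq.{u, v, x} k K} {ω : Ω[K⁄k]} {θ : K}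
    {φ : E₁.M ≃ₗ[K] E₂.M} (hθ : θ ≠ 0) (hω : D k K θ = θ • ω) (he : φ E₁.e = E₂.e)
    (hφ : ∀ m : E₁.M, E₂.conn.toFun (φ m)
      = LinearMap.lTensor (Ω[K⁄k]) φ.toLinearMap (E₁.conn.toFun m) + ω ⊗ₜ[K] φ m)
    {y : K} (hy : E₂.IsSolution y) : E₁.IsSolution (θ⁻¹ * y) := by
  obtain ⟨σ, hσ, rfl⟩ := hy
  refine ⟨θ⁻¹ • σ.comp φ.toLinearMap, fun m => ?_, by simp [he]⟩
  have h1 := hσ (φ m)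
  rw [hφ, map_add, map_add, LinearMap.lTensor_tmul, TensorProduct.rid_tmul] at h1
  have hinv : D k K θ⁻¹ = -(θ⁻¹ • ω) := by
    rw [Derivation.leibniz_inv, hω, smul_smul, ← neg_smul]
    congr 1
    field_simp
  have h2 : (σ.comp φ.toLinearMap) m = σ (φ m) := rfl
  rw [LinearMap.smul_apply, h2, smul_eq_mul, Derivation.leibniz, hinv, ← h1,
    LinearMap.lTensor_smul, LinearMap.smul_apply, map_smul, LinearMap.lTensor_comp,
    LinearMap.comp_apply, smul_add, smul_neg, smul_comm (σ (φ m)) θ⁻¹ ω]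
  abel

end DiffEq

section Exponents

variable {k : Type u} {L : Type w} [Field k] [PerfectField k] [Field L] [Algebra k L]
  (p : ℕ) [hp : Fact p.Prime] [CharP k p]

namespace Place

/-- The derivation `T d/dT` does not decrease orders at `Q`, provided that `p ∤ ord_Q T`; it
preserves exactly the orders that are not divisible by `p`. For a tame cover this applies to the
pull back `T` of a local parameter. -/
theorem val_mul_derivation (hL : IsCurve k L) {Q : Place k L} {d : Derivation k L L} {T : L}
    (hT : d T = 1) (hT0 : T ≠ 0) (hord : ¬ (p : ℤ) ∣ Q.ord T) {f : L} (hf : f ≠ 0) :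
    (¬ (p : ℤ) ∣ Q.ord f → Q.val (T * d f) = Q.val f) ∧
      ((p : ℤ) ∣ Q.ord f → Q.val (T * d f) < Q.val f) := by
  obtain ⟨s, hs⟩ := Q.exists_isLocalParameter
  obtain ⟨a, ha, ha1, -⟩ := val_derivation p hL hs d hT0
  obtain ⟨b, hb, hb1, hb2⟩ := val_derivation p hL hs d hf
  rw [hT, mul_one] at ha
  have hvs : Q.val s ≠ 0 := by simpa using hs.ne_zero
  have h1 : Q.val s = Q.val (d s) * Q.val T := by rw [← ha1 hord, ← map_mul, ← ha]
  have key : Q.val (T * d f) = Q.val b := by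
    refine mul_left_cancel₀ hvs ?_
    rw [← map_mul, show s * (T * d f) = T * (s * d f) by ring, hb, map_mul, map_mul, h1]
    ac_rfl
  rw [key]
  exact ⟨hb1, hb2⟩

/-- If both local exponents at `Q` are `γ`, then `T y' / y` takes the value `γ` at `Q` for every
nonzero solution `y`: its value is a root of the indicial polynomial. -/
theorem val_logDeriv_sub_lt_one (hL : IsCurve k L) {Q : Place k L} {d : Derivation k L L} {T : L}
    (hT : d T = 1) (hT0 : T ≠ 0) (hord : ¬ (p : ℤ) ∣ Q.ord T) {b₁ b₂ γ y : L} (hy : y ≠ 0)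
    (heq : d (d y) = -(b₂ * y) - b₁ * d y)
    (h₁ : Q.val (T * b₁ - 1 + 2 * γ) < 1) (h₂ : Q.val (T ^ 2 * b₂ - γ ^ 2) < 1) :
    Q.val (T * d y / y - γ) < 1 := by
  have hϑ : ∀ f : L, f ≠ 0 → Q.val (T * d f) ≤ Q.val f := fun f hf => by
    obtain ⟨h1, h2⟩ := val_mul_derivation p hL hT hT0 hord hf
    by_cases h : (p : ℤ) ∣ Q.ord f
    · exact (h2 h).le
    · exact (h1 h).le
  set l := T * d y / y with hl
  have hvy : Q.val y ≠ 0 := by simpa using hy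
  have hl1 : Q.val l ≤ 1 := by
    rw [hl, map_div₀]
    exact div_le_one_of_le₀ (hϑ y hy) zero_le
  have hl2 : Q.val (T * d l) < 1 := by
    rcases eq_or_ne l 0 with h0 | h0
    · simp [h0]
    obtain ⟨h1, h2⟩ := val_mul_derivation p hL hT hT0 hord h0
    by_cases h : (p : ℤ) ∣ Q.ord l
    · exact (h2 h).trans_le hl1
    · rw [h1 h]
      refine lt_of_le_of_ne hl1 fun h' => h ?_
      rw [(ord_eq_iff h0 (n := 0)).2 (by simpa using h')]
      exact dvd_zero _
  have hdl : T * d l = l - l ^ 2 - T ^ 2 * b₂ - T * b₁ * l := by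
    rw [hl, Derivation.leibniz_div, Derivation.leibniz, heq, hT]
    simp only [smul_eq_mul]
    field_simp
    ring
  have hsq : (l - γ) ^ 2 = -(T * d l) - (T * b₁ - 1 + 2 * γ) * l - (T ^ 2 * b₂ - γ ^ 2) := by
    rw [hdl]
    ring
  have hsq' : Q.val ((l - γ) ^ 2) < 1 := by
    rw [hsq]
    refine Valuation.map_sub_lt _ (Valuation.map_sub_lt _ ?_ ?_) h₂
    · rwa [Valuation.map_neg]
    · rw [map_mul]
      exact mul_lt_one_of_lt_of_le h₁ hl1
  rw [map_pow] at hsq'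
  exact (pow_lt_one_iff two_ne_zero).1 hsq'

/-- If the two local exponents at some point are equal, then nonzero solutions of a scalar equation
of order two are unique up to multiplication by a `p`-th power. -/
theorem exists_eq_pow_mul_of_equal_exponents (hL : IsCurve k L) {Q : Place k L}
    {d : Derivation k L L} {T : L} (hT : d T = 1) (hT0 : T ≠ 0) (hord : ¬ (p : ℤ) ∣ Q.ord T)
    {b₁ b₂ γ : L} (h₁ : Q.val (T * b₁ - 1 + 2 * γ) < 1) (h₂ : Q.val (T ^ 2 * b₂ - γ ^ 2) < 1)
    {y z : L} (hy : y ≠ 0) (hz : z ≠ 0) (hyeq : d (d y) = -(b₂ * y) - b₁ * d y)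
    (hzeq : d (d z) = -(b₂ * z) - b₁ * d z) : ∃ c : L, c ≠ 0 ∧ y = c ^ p * z := by
  have : CharP L p := charP_of_injective_algebraMap (algebraMap k L).injective p
  have hratio : ∀ u : L, u ≠ 0 → d (d u) = -(b₂ * u) - b₁ * d u → (p : ℤ) ∣ Q.ord (u / z) := by
    intro u hu hueq
    by_contra hndvd
    have hr : u / z ≠ 0 := div_ne_zero hu hz
    have h := (val_mul_derivation p hL hT hT0 hord hr).1 hndvd
    have hu' := val_logDeriv_sub_lt_one p hL hT hT0 hord hu hueq h₁ h₂
    have hz' := val_logDeriv_sub_lt_one p hL hT hT0 hord hz hzeq h₁ h₂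
    have h3 : T * d (u / z) = ((T * d u / u - γ) - (T * d z / z - γ)) * (u / z) := by
      rw [Derivation.leibniz_div]
      simp only [smul_eq_mul]
      field_simp
      ring
    have h4 := Valuation.map_sub_lt _ hu' hz'
    rw [h3, map_mul] at h
    have h5 : Q.val (u / z) ≠ 0 := by
      rw [Valuation.ne_zero_iff]
      exact hr
    have h6 := mul_lt_mul_of_pos_right h4 (zero_lt_iff.2 h5)
    rw [h, one_mul] at h6
    exact lt_irrefl _ h6
  obtain ⟨c, hc⟩ := exists_eq_pow_of_forall_dvd_ord p hL Q (y / z) fun c hc => by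
    have hsub : y / z - c ^ p = (y - c ^ p * z) / z := by field_simp
    rw [hsub]
    refine hratio _ (fun h0 => hc ?_) ?_
    · rw [sub_eq_zero.1 h0, mul_div_cancel_right₀ _ hz]
    · have hd : ∀ u : L, d (c ^ p * u) = c ^ p * d u := fun u => by
        rw [Derivation.leibniz, Derivation.map_pow_char p, smul_zero, add_zero, smul_eq_mul]
      rw [map_sub, hd, map_sub, hd, hyeq, hzeq]
      ring
  refine ⟨c, ?_, by rw [← hc, div_mul_cancel₀ _ hz]⟩
  rintro rfl
  rw [zero_pow hp.out.ne_zero] at hc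
  exact div_ne_zero hy hz hc

/-- Where the logarithmic differential `ω = dθ / θ` is holomorphic, the order of `θ` is divisible
by `p`. -/
theorem dvd_ord_of_formIsHolomorphicAt (hL : IsCurve k L) {Q : Place k L} {ω : Ω[L⁄k]} {θ : L}
    (hθ : θ ≠ 0) (hω : D k L θ = θ • ω) (hol : DiffEq.FormIsHolomorphicAt ω Q)
    {d : Derivation k L L} {T : L} (hT : d T = 1) : (p : ℤ) ∣ Q.ord θ := by
  obtain ⟨t, b, ht, hb, rfl⟩ := hol
  have hT0 : T ≠ 0 := by
    rintro rfl
    simp at hT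
  have hdt : d t ≠ 0 := by
    obtain ⟨a, ha, -⟩ := val_derivation p hL ht d hT0
    rintro h0
    rw [hT, h0, zero_mul, mul_one] at ha
    exact ht.ne_zero ha
  have hdθ : d θ = θ * (b * d t) := by
    have := congrArg d.liftKaehlerDifferential hω
    simpa using this
  obtain ⟨a, ha, ha1, -⟩ := val_derivation p hL ht d hθ
  have ha' : a = t * b * θ := by
    apply mul_left_cancel₀ hdt
    rw [← ha, hdθ]
    ring
  by_contra hndvd
  have h1 := ha1 hndvd
  have hvt : Q.val t < 1 := by
    rw [ht, ← WithZero.exp_zero]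
    exact WithZero.exp_lt_exp.2 (by norm_num)
  have h2 : Q.val (t * b) < 1 := by
    rw [map_mul]
    exact mul_lt_one_of_lt_of_le hvt hb
  have h5 : Q.val θ ≠ 0 := by simpa using hθ
  have h6 := mul_lt_mul_of_pos_right h2 (zero_lt_iff.2 h5)
  rw [← map_mul, ← ha', h1, one_mul] at h6
  exact lt_irrefl _ h6

end Place

/-- For an adapted pair of covers, the divisibility by `p` of the order of the solution at a regular
point can be tested with either cover. -/
theorem DiffEq.IsAdapted.dvd_ord_iff {K : Type v} [Field K] [Algebra k K]
    {E : DiffEq.{u, v, x} k K} {g h : K →ₐ[k] L} (hadapted : E.IsAdapted g h)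
    (hL : IsCurve k L) (hgsep : IsSeparableCover g) (hgtame : IsTameCover p g)
    {P₀ : Place k K} {Q₀ : Place k L} (hP₀ : E.HasEqualLocalExponents P₀)
    (hQ₀ : Place.LiesOver g P₀ Q₀) {Φ : K} (hΦ : E.IsSolution Φ) (hΦ0 : Φ ≠ 0)
    {Q : Place k L} (hQ : Q ∉ (E.pullback g).sing) :
    (p : ℤ) ∣ Q.ord (g Φ) ↔ (p : ℤ) ∣ Q.ord (h Φ) := by
  obtain ⟨ω, θ, φ, hθ, hω, hpole, he, hφ⟩ := hadapted
  obtain ⟨t, d, a₁, a₂, γ, hloc, -, -, -, hc₁, hc₂⟩ := hP₀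
  obtain ⟨n, hn⟩ := hQ₀
  obtain ⟨d', hd'⟩ : ∃ d' : Derivation k L L, ∀ f, d' (g f) = g (d f) := by
    let _ : Algebra K L := g.toRingHom.toAlgebra
    have : IsScalarTower k K L := IsScalarTower.of_algebraMap_eq fun c => (g.commutes c).symm
    have : Algebra.IsSeparable K L := hgsep.algebra_isSeparable
    exact exists_derivation_extension d
  have hT : d' (g t) = 1 := by rw [hd', hloc.2.1, map_one]
  have ht0 := hloc.1.ne_zero
  have hT0 : g t ≠ 0 := by simpa using ht0
  have hord : ¬ (p : ℤ) ∣ Q₀.ord (g t) := by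
    rw [hn.ord_eq ht0, hloc.1.ord, mul_one, Int.natCast_dvd_natCast]
    exact hgtame _ _ _ hn
  have h₁ : Q₀.val (g t * g a₁ - 1 + 2 * g γ) < 1 := by
    have := hn.val_lt_one_iff.2 hc₁
    simpa [two_mul] using this
  have h₂ : Q₀.val (g t ^ 2 * g a₂ - g γ ^ 2) < 1 := by
    have := hn.val_lt_one_iff.2 hc₂
    simpa using this
  have hgΦ : g Φ ≠ 0 := by simpa using hΦ0
  have hhΦ : h Φ ≠ 0 := by simpa using hΦ0
  have s₁ := hΦ.pullback g
  have s₂ := DiffEq.isSolution_inv_mul hθ hω he hφ (hΦ.pullback h)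
  obtain ⟨c, hc0, hc⟩ := Place.exists_eq_pow_mul_of_equal_exponents p hL hT hT0 hord h₁ h₂ hgΦ
    (mul_ne_zero (inv_ne_zero hθ) hhΦ) (s₁.scalar_equation hloc hd') (s₂.scalar_equation hloc hd')
  have hθdvd : (p : ℤ) ∣ Q.ord θ := by
    refine Place.dvd_ord_of_formIsHolomorphicAt p hL hθ hω ?_ hT
    by_contra hcon
    exact hQ (hpole Q hcon)
  have hprod : g Φ * θ = c ^ p * h Φ := by
    rw [hc]
    field_simp
  have hord2 := congrArg Q.ord hprod
  rw [Q.ord_mul hgΦ hθ, Q.ord_mul (pow_ne_zero _ hc0) hhΦ, Q.ord_pow hc0] at hord2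
  have e1 : (p : ℤ) ∣ Q.ord (g Φ) ↔ (p : ℤ) ∣ Q.ord (g Φ) + Q.ord θ :=
    (dvd_add_left hθdvd).symm
  rw [e1, hord2]
  exact dvd_add_right (dvd_mul_right _ _)

end Exponents

/-! ### Places and prime ideals -/

namespace Place

section Dedekind

open IsDedekindDomain

variable {k : Type u} {F : Type v} {F' : Type w} [Field k] [Field F] [Algebra k F] [Field F']
  [Algebra k F'] [Algebra F F'] [IsScalarTower k F F']
  {O : Type*} [CommRing O] [Algebra O F] [Algebra O F'] [IsScalarTower O F F']
  {S : Type*} [CommRing S] [IsDedekindDomain S] [Algebra O S] [Algebra S F'] [IsScalarTower O S F']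
  [IsFractionRing S F'] {P : Place k F}

/-- The place defined by a nonzero prime ideal of a Dedekind domain with field of fractions `F'`
that contains the valuation ring of `P`. -/
def ofPrime (F' : Type w) [Field F'] [Algebra k F'] [Algebra F F'] [IsScalarTower k F F']
    [Algebra O F'] [IsScalarTower O F F'] [Algebra S F'] [IsScalarTower O S F']
    [IsFractionRing S F'] (hO : ∀ x : F, P.val x ≤ 1 ↔ ∃ a : O, algebraMap O F a = x)
    (q : HeightOneSpectrum S) : Place k F' where
  val := q.valuation F'
  surjective := q.valuation_surjective F'
  map_const := by
    have h : ∀ c : k, q.valuation F' (algebraMap k F' c) ≤ 1 := fun c => by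
      obtain ⟨a, ha⟩ := (hO _).1 (P.val_const_le c)
      rw [IsScalarTower.algebraMap_apply k F F', ← ha, ← IsScalarTower.algebraMap_apply O F F',
        IsScalarTower.algebraMap_apply O S F']
      exact q.valuation_le_one _
    intro c hc
    refine le_antisymm (h c) ?_
    have h1 := h c⁻¹
    rw [map_inv₀, map_inv₀] at h1
    exact (inv_le_one₀ (zero_lt_iff.2 (by simpa using hc))).1 h1

theorem liesOver_ofPrime [Algebra.IsIntegral F F']
    (hO : ∀ x : F, P.val x ≤ 1 ↔ ∃ a : O, algebraMap O F a = x)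
    (q : HeightOneSpectrum S) : LiesOver (IsScalarTower.toAlgHom k F F') P (ofPrime F' hO q) := by
  obtain ⟨P', n, hn⟩ := exists_liesOver_of_isIntegral (F := F) (ofPrime F' hO q)
  have : P = P' := eq_of_le_one fun x hx => by
    rw [← hn.val_le_one_iff]
    obtain ⟨a, rfl⟩ := (hO _).1 hx
    change q.valuation F' (algebraMap F F' (algebraMap O F a)) ≤ 1
    rw [← IsScalarTower.algebraMap_apply O F F', IsScalarTower.algebraMap_apply O S F']
    exact q.valuation_le_one _
  subst this
  exact ⟨n, hn⟩

theorem ofPrime_injective (hO : ∀ x : F, P.val x ≤ 1 ↔ ∃ a : O, algebraMap O F a = x) :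
    Function.Injective (ofPrime (S := S) F' hO) := fun q q' h => by
  apply HeightOneSpectrum.eq_of_valuation_isEquiv_valuation (K := F')
  have : q.valuation F' = q'.valuation F' := congrArg Place.val h
  rw [this]

/-- Every place over `P` is given by its centre in `S`. -/
theorem exists_ofPrime_eq [IsIntegralClosure S O F']
    (hO : ∀ x : F, P.val x ≤ 1 ↔ ∃ a : O, algebraMap O F a = x) {R : Place k F'}
    (hR : LiesOver (IsScalarTower.toAlgHom k F F') P R) :
    ∃ q : HeightOneSpectrum S, ofPrime F' hO q = R := by
  obtain ⟨n, hn⟩ := hR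
  have hRO : ∀ a : O, R.val (algebraMap O F' a) ≤ 1 := fun a => by
    rw [IsScalarTower.algebraMap_apply O F F']
    exact hn.val_le_one_iff.2 ((hO _).2 ⟨a, rfl⟩)
  have hRS : ∀ y : S, R.val (algebraMap S F' y) ≤ 1 := fun y =>
    val_le_one_of_isIntegral R hRO
      ((IsIntegralClosure.isIntegral_iff (A := S)).2 ⟨y, rfl⟩)
  let I : Ideal S :=
    { carrier := {y | R.val (algebraMap S F' y) < 1}
      zero_mem' := by simp
      add_mem' := fun {a b} ha hb => by
        change R.val (algebraMap S F' (a + b)) < 1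
        rw [map_add]
        exact Valuation.map_add_lt _ ha hb
      smul_mem' := fun c y hy => by
        change R.val (algebraMap S F' (c * y)) < 1
        rw [map_mul, map_mul, mul_comm]
        exact mul_lt_one_of_lt_of_le hy (hRS c) }
  have hImem : ∀ y, y ∈ I ↔ R.val (algebraMap S F' y) < 1 := fun y => Iff.rfl
  have hI : I.IsPrime := by
    refine Ideal.isPrime_iff.2 ⟨fun h => ?_, fun {a b} hab => ?_⟩
    · have := (hImem 1).1 (h ▸ trivial)
      simp at this
    · by_contra! hcon
      rw [hImem, hImem, not_lt, not_lt] at hcon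
      rw [hImem, map_mul, map_mul] at hab
      exact absurd hab (not_lt.2 (by simpa using mul_le_mul' hcon.1 hcon.2))
  have hI0 : I ≠ ⊥ := by
    obtain ⟨t, ht⟩ := P.exists_isLocalParameter
    have ht1 : P.val t < 1 := by
      rw [ht, ← WithZero.exp_zero]
      exact WithZero.exp_lt_exp.2 (by norm_num)
    obtain ⟨a, rfl⟩ := (hO t).1 ht1.le
    have h1 : R.val (algebraMap S F' (algebraMap O S a)) < 1 := by
      rw [← IsScalarTower.algebraMap_apply O S F', IsScalarTower.algebraMap_apply O F F']
      exact hn.val_lt_one_iff.2 ht1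
    intro h0
    have h2 : algebraMap O S a = 0 := by
      have := (hImem _).2 h1
      rwa [h0, Ideal.mem_bot] at this
    have h3 : algebraMap O F' a = 0 := by
      rw [IsScalarTower.algebraMap_apply O S F', h2, map_zero]
    rw [IsScalarTower.algebraMap_apply O F F'] at h3
    exact ht.ne_zero (by simpa using h3)
  let q : HeightOneSpectrum S := ⟨I, hI, hI0⟩
  refine ⟨q, eq_of_le_one fun x hx => ?_⟩
  obtain ⟨m, d, hd⟩ := q.exists_primeCompl_mul_eq_of_integer x hx
  have hd1 : R.val (algebraMap S F' d) = 1 := by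
    refine le_antisymm (hRS _) (not_lt.1 fun h => ?_)
    exact d.2 h
  have h2 := congrArg R.val hd
  rw [map_mul, hd1, mul_one] at h2
  rw [h2]
  exact hRS m

/-- Places over `P` correspond to the nonzero prime ideals of the integral closure. -/
def primeEquiv [IsIntegralClosure S O F'] [Algebra.IsIntegral F F']
    (hO : ∀ x : F, P.val x ≤ 1 ↔ ∃ a : O, algebraMap O F a = x) :
    HeightOneSpectrum S ≃ {R : Place k F' // LiesOver (IsScalarTower.toAlgHom k F F') P R} :=
  Equiv.ofBijective (fun q => ⟨ofPrime F' hO q, liesOver_ofPrime hO q⟩)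
    ⟨fun q q' h => ofPrime_injective hO (congrArg Subtype.val h), fun R => by
      obtain ⟨q, hq⟩ := exists_ofPrime_eq (S := S) hO R.2
      exact ⟨q, Subtype.ext hq⟩⟩

/-- Over a discrete valuation ring, all nonzero primes lie over the maximal ideal. -/
def primesOverEquiv [IsDomain O] [IsDiscreteValuationRing O] [Algebra.IsIntegral O S]
    [FaithfulSMul O S] :
    (IsLocalRing.maximalIdeal O).primesOver S ≃ HeightOneSpectrum S where
  toFun q := ⟨q.1, q.2.1, by
    have := q.2.1
    have := q.2.2
    exact Ideal.ne_bot_of_liesOver_of_ne_bot (IsDiscreteValuationRing.not_a_field O) q.1⟩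
  invFun q := ⟨q.asIdeal, q.isPrime, ⟨by
    have := q.isMaximal
    exact (IsLocalRing.eq_maximalIdeal (Ideal.isMaximal_comap_of_isIntegral_of_isMaximal
      (R := O) q.asIdeal)).symm⟩⟩
  left_inv _ := rfl
  right_inv _ := rfl

end Dedekind

section Fundamental

open IsDedekindDomain

variable {F : Type v} {F' : Type w} [Field F] [Field F'] [Algebra F F']
  {O : Type*} [CommRing O] [IsDomain O] [IsDiscreteValuationRing O] [Algebra O F] [Algebra O F']
  [IsScalarTower O F F'] [IsFractionRing O F]
  {S : Type*} [CommRing S] [IsDedekindDomain S] [Algebra O S] [Algebra S F'] [IsScalarTower O S F']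
  [IsIntegralClosure S O F'] [FiniteDimensional F F'] [Algebra.IsSeparable F F']

/-- Consequences of the fundamental identity `∑ e f = [F' : F]` for the number of primes over the
maximal ideal of a discrete valuation ring. -/
theorem card_primes_le_finrank [Module.Finite O S] [FaithfulSMul O S] :
    Finite (HeightOneSpectrum S) ∧ Nat.card (HeightOneSpectrum S) ≤ Module.finrank F F' ∧
      0 < Nat.card (HeightOneSpectrum S) ∧
      ((∀ q ∈ (IsLocalRing.maximalIdeal O).primesOver S,
        q.ramificationIdx O = 1 ∧ q.inertiaDeg O = 1) →
        Nat.card (HeightOneSpectrum S) = Module.finrank F F') := by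
  have hfin : Finite ((IsLocalRing.maximalIdeal O).primesOver S) :=
    Set.finite_coe_iff.2 (IsDedekindDomain.primesOver_finite _ _)
  let _ := Fintype.ofFinite ((IsLocalRing.maximalIdeal O).primesOver S)
  have : Module.Flat O S := inferInstance
  have hsum := Ideal.sum_ramification_inertia_eq_finrank (IsLocalRing.maximalIdeal O) S
  have : FaithfulSMul O F := (faithfulSMul_iff_algebraMap_injective O F).2
    (IsFractionRing.injective O F)
  have : Module.IsTorsionFree O F' := .trans_faithfulSMul O F F'
  have hrank : Module.finrank O S = Module.finrank F F' := IsIntegralClosure.rank O F F' S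
  rw [hrank] at hsum
  have hcard : Nat.card (HeightOneSpectrum S) =
      Fintype.card ((IsLocalRing.maximalIdeal O).primesOver S) := by
    rw [← Nat.card_congr (primesOverEquiv (O := O) (S := S)), Nat.card_eq_fintype_card]
  refine ⟨Finite.of_equiv _ (primesOverEquiv (O := O) (S := S)), ?_, ?_, fun h => ?_⟩
  · rw [hcard, ← hsum, ← Finset.card_univ, Finset.card_eq_sum_ones]
    refine Finset.sum_le_sum fun q _ => ?_
    have := q.2.1
    exact Nat.one_le_iff_ne_zero.2
      (mul_pos (Ideal.ramificationIdx_pos q.1 O) (Ideal.inertiaDeg_pos q.1 O)).ne'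
  · rw [hcard, Fintype.card_pos_iff]
    by_contra hcon
    rw [not_nonempty_iff] at hcon
    rw [Finset.univ_eq_empty, Finset.sum_empty] at hsum
    exact Module.finrank_pos.ne hsum
  · rw [hcard, ← hsum, ← Finset.card_univ, Finset.card_eq_sum_ones]
    refine Finset.sum_congr rfl fun q _ => ?_
    rw [(h q.1 q.2).1, (h q.1 q.2).2]

end Fundamental

end Place

/-! ### Completely split places -/

namespace Place

section Splitting

open IsDedekindDomain

variable {k : Type u} {F : Type v} {F' : Type w} [Field k] [Field F] [Algebra k F] [Field F']
  [Algebra k F']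

theorem IsLocalParameter.val_lt_one {P : Place k F} {t : F} (ht : P.IsLocalParameter t) :
    P.val t < 1 := by
  rw [ht, ← WithZero.exp_zero]
  exact WithZero.exp_lt_exp.2 (by norm_num)

theorem HasRamificationIdx.unique {A : Type*} [CommRing A] [Algebra k A] {g : F →ₐ[k] A}
    {P : Place k F} {Q : Place k A} {n m : ℕ} (hn : HasRamificationIdx g P Q n)
    (hm : HasRamificationIdx g P Q m) : n = m := by
  obtain ⟨t, ht⟩ := P.exists_isLocalParameter
  have h := hn t
  rw [hm t, ht, ← WithZero.exp_nsmul, ← WithZero.exp_nsmul, WithZero.exp_inj] at h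
  simp at h
  omega

theorem exists_eq_mul_of_val_lt_one {P : Place k F} {t f : F} (ht : P.IsLocalParameter t)
    (hf : P.val f < 1) : ∃ b, P.val b ≤ 1 ∧ f = t * b := by
  refine ⟨f / t, ?_, (mul_div_cancel₀ f ht.ne_zero).symm⟩
  rcases eq_or_ne f 0 with rfl | hf0
  · simp
  rw [val_eq_exp hf0, ← WithZero.exp_zero, WithZero.exp_lt_exp] at hf
  rw [map_div₀, ht, val_eq_exp hf0, ← WithZero.exp_sub, ← WithZero.exp_zero, WithZero.exp_le_exp]
  omega

variable [Algebra F F'] [IsScalarTower k F F']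

/-- The place `P` splits completely in the extension `F' / F`. -/
def SplitsCompletely (F' : Type w) [Field F'] [Algebra k F'] [Algebra F F'] [IsScalarTower k F F']
    (P : Place k F) : Prop :=
  ∀ (R : Place k F') (n : ℕ), HasRamificationIdx (IsScalarTower.toAlgHom k F F') P R n →
    n = 1 ∧ R.IsRational

variable [FiniteDimensional F F'] [Algebra.IsSeparable F F']

/-- The places over `P`: there is at least one, at most `[F' : F]`, and in the completely split case
exactly `[F' : F]` of them, which can then be separated by functions. -/
theorem placesOver (P : Place k F) :
    Finite {R : Place k F' // LiesOver (IsScalarTower.toAlgHom k F F') P R} ∧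
    Nat.card {R : Place k F' // LiesOver (IsScalarTower.toAlgHom k F F') P R} ≤
      Module.finrank F F' ∧
    0 < Nat.card {R : Place k F' // LiesOver (IsScalarTower.toAlgHom k F F') P R} ∧
    (P.SplitsCompletely F' →
      Nat.card {R : Place k F' // LiesOver (IsScalarTower.toAlgHom k F F') P R} =
        Module.finrank F F') ∧
    ∀ R₀ : {R : Place k F' // LiesOver (IsScalarTower.toAlgHom k F F') P R},
      ∃ e : F', R₀.1.val (e - 1) < 1 ∧
        ∀ R : {R : Place k F' // LiesOver (IsScalarTower.toAlgHom k F F') P R},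
          R ≠ R₀ → R.1.val e < 1 := by
  classical
  obtain ⟨t, ht⟩ := P.exists_isLocalParameter
  have : P.val.IsNontrivial := ⟨t, by simpa using ht.ne_zero, ht.val_lt_one.ne⟩
  let O := P.val.valuationSubring
  let S := integralClosure O F'
  have hO : ∀ x : F, P.val x ≤ 1 ↔ ∃ a : O, algebraMap O F a = x := fun x =>
    ⟨fun h => ⟨⟨x, h⟩, rfl⟩, fun ⟨a, ha⟩ => ha ▸ a.2⟩
  have : Module.Finite O S := IsIntegralClosure.finite O F F' S
  have : IsDedekindDomain S := integralClosure.isDedekindDomain O F F'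
  have : IsFractionRing S F' := integralClosure.isFractionRing_of_finite_extension F F'
  have hinjF : Function.Injective (algebraMap O F') := by
    rw [IsScalarTower.algebraMap_eq O F F']
    exact (algebraMap F F').injective.comp (IsFractionRing.injective O F)
  have : FaithfulSMul O F' := (faithfulSMul_iff_algebraMap_injective O F').2 hinjF
  have hinj : Function.Injective (algebraMap O S) := by
    rw [IsScalarTower.algebraMap_eq O S F', RingHom.coe_comp] at hinjF
    exact Function.Injective.of_comp hinjF
  have : FaithfulSMul O S := (faithfulSMul_iff_algebraMap_injective O S).2 hinj
  let e : HeightOneSpectrum S ≃ {R : Place k F' // LiesOver (IsScalarTower.toAlgHom k F F') P R} :=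
    primeEquiv hO
  obtain ⟨hfin, hle, hpos, heq⟩ := card_primes_le_finrank (F := F) (F' := F') (O := O) (S := S)
  refine ⟨Finite.of_equiv _ e, ?_, ?_, fun hsplit => ?_, fun R₀ => ?_⟩
  · rwa [← Nat.card_congr e]
  · rwa [← Nat.card_congr e]
  · rw [← Nat.card_congr e]
    refine heq fun q hq => ?_
    have hqp := hq.1
    have hqo := hq.2
    let q' : HeightOneSpectrum S := primesOverEquiv (O := O) ⟨q, hq⟩
    have hqm : q.IsMaximal := q'.isMaximal
    obtain ⟨n, hn⟩ := (e q').2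
    have hrat := (hsplit _ _ hn).2
    have hn1 := (hsplit _ _ hn).1
    have hval : ∀ y : S, (e q').1.val (algebraMap S F' y) = q'.intValuation y := fun y =>
      q'.valuation_of_algebraMap y
    constructor
    · rw [← Ideal.ramificationIdx'_eq_ramificationIdx (IsLocalRing.maximalIdeal O) q
        (IsDiscreteValuationRing.not_a_field O)]
      refine Ideal.ramificationIdx'_spec ?_ fun h => ?_
      · rw [pow_one]
        exact Ideal.map_le_of_le_comap hqo.over.le
      · let t' : O := ⟨t, ht.val_lt_one.le⟩
        have ht' : t' ∈ IsLocalRing.maximalIdeal O := by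
          rw [IsLocalRing.mem_maximalIdeal, mem_nonunits_iff]
          intro hu
          obtain ⟨b, hb⟩ := hu.exists_right_inv
          have h1 : t * (b : F) = 1 := congrArg Subtype.val hb
          have h2 := congrArg P.val h1
          rw [map_mul, map_one] at h2
          exact (mul_lt_one_of_lt_of_le ht.val_lt_one b.2).ne h2
        have h1 := h (Ideal.mem_map_of_mem _ ht')
        have h2 : q'.intValuation (algebraMap O S t') ≤ WithZero.exp (-(2 : ℕ) : ℤ) :=
          (q'.intValuation_le_pow_iff_mem _ _).2 h1
        rw [← hval, ← IsScalarTower.algebraMap_apply O S F',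
          IsScalarTower.algebraMap_apply O F F'] at h2
        have h3 := hn t
        rw [hn1, pow_one, ht] at h3
        change (e q').1.val (algebraMap F F' t) ≤ _ at h2
        change (e q').1.val (algebraMap F F' t) = _ at h3
        rw [h3, WithZero.exp_le_exp] at h2
        norm_num at h2
    · rw [Ideal.inertiaDeg_eq_of_isMaximal (IsLocalRing.maximalIdeal O) q]
      let _ : Field (O ⧸ IsLocalRing.maximalIdeal O) := Ideal.Quotient.field _
      refine finrank_eq_one (1 : S ⧸ q) one_ne_zero fun w => ?_
      obtain ⟨y, rfl⟩ := Ideal.Quotient.mk_surjective w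
      obtain ⟨c, hc⟩ := hrat (algebraMap S F' y) (by
        rw [hval]
        exact q'.intValuation_le_one _)
      obtain ⟨a, ha⟩ := (hO _).1 (P.val_const_le c)
      refine ⟨Ideal.Quotient.mk _ a, ?_⟩
      rw [← Ideal.Quotient.algebraMap_eq, ← Algebra.algebraMap_eq_smul_one]
      change Ideal.Quotient.mk q (algebraMap O S a) = _
      rw [eq_comm, Ideal.Quotient.eq]
      rw [IsScalarTower.algebraMap_apply k F F', ← ha, ← IsScalarTower.algebraMap_apply O F F',
        IsScalarTower.algebraMap_apply O S F', ← map_sub, hval] at hc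
      exact (q'.intValuation_lt_one_iff_mem _).1 hc
  · obtain ⟨y, hy⟩ := Ideal.exists_forall_sub_mem_ideal (I := fun q : HeightOneSpectrum S =>
      q.asIdeal) (fun q q' hne => HeightOneSpectrum.isCoprime_of_ne q q' hne)
      (fun q => if q = e.symm R₀ then 1 else 0)
    have hval : ∀ (q : HeightOneSpectrum S) (y : S), y ∈ q.asIdeal →
        (e q).1.val (algebraMap S F' y) < 1 := fun q y hy => by
      change q.valuation F' _ < 1
      rw [q.valuation_of_algebraMap]
      exact (q.intValuation_lt_one_iff_mem _).2 hy
    refine ⟨algebraMap S F' y, ?_, fun R hR => ?_⟩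
    · have h := hval _ _ (hy (e.symm R₀))
      rw [if_pos rfl, map_sub, map_one, Equiv.apply_symm_apply] at h
      exact h
    · have h := hval _ _ (hy (e.symm R))
      rw [if_neg (fun h => hR (e.symm.injective h)), sub_zero, Equiv.apply_symm_apply] at h
      exact h

/-- At a completely split place `P`, the extension has a basis of approximate idempotents: modulo
the maximal ideal at `P`, the `b i` are orthogonal idempotents with sum one. -/
theorem SplitsCompletely.exists_basis {P : Place k F} (hP : P.SplitsCompletely F') :
    ∃ (ι : Type w) (_ : Fintype ι) (_ : DecidableEq ι) (b : Module.Basis ι F F'),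
      (∀ i j, ∃ a : ι → F, (∀ l, P.val (a l) < 1) ∧
        b i * b j = (if i = j then b i else 0) + ∑ l, a l • b l) ∧
      ∃ a : ι → F, (∀ l, P.val (a l) < 1) ∧ ∑ i, b i = 1 + ∑ l, a l • b l := by
  classical
  obtain ⟨hfin, -, hpos, hcard, hidem⟩ := placesOver (F' := F') P
  replace hcard := hcard hP
  set ι := {R : Place k F' // LiesOver (IsScalarTower.toAlgHom k F F') P R} with hι
  let _ : Fintype ι := Fintype.ofFinite ι
  have hne : Nonempty ι := (Nat.card_pos_iff.1 hpos).1
  choose e he1 he2 using hidem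
  have hunr : ∀ (R : ι) (f : F), R.1.val (algebraMap F F' f) = P.val f := fun R f => by
    obtain ⟨n, hn⟩ := R.2
    have := hn f
    rwa [(hP _ _ hn).1, pow_one] at this
  have heR : ∀ R : ι, R.1.val (e R) = 1 := fun R => by
    have := Valuation.map_add_eq_of_lt_left (v := R.1.val) (x := 1) (y := e R - 1)
      (by simpa using he1 R)
    simpa using this
  -- the value of `∑ a_R e_R` is attained at some place
  have key : ∀ a : ι → F, ∃ R₀ : ι, (∀ R, P.val (a R) ≤ P.val (a R₀)) ∧
      R₀.1.val (∑ R, a R • e R) = P.val (a R₀) := fun a => by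
    obtain ⟨R₀, -, hR₀⟩ := Finset.exists_max_image Finset.univ (fun R => P.val (a R))
      Finset.univ_nonempty
    replace hR₀ : ∀ R, P.val (a R) ≤ P.val (a R₀) := fun R => hR₀ R (Finset.mem_univ R)
    refine ⟨R₀, hR₀, ?_⟩
    have h0 : R₀.1.val (a R₀ • e R₀) = P.val (a R₀) := by
      rw [Algebra.smul_def, map_mul, hunr, heR, mul_one]
    rcases eq_or_ne (a R₀) 0 with ha | ha
    · have : ∀ R, a R = 0 := fun R => by
        have := hR₀ R
        rwa [ha, map_zero, le_zero_iff, Valuation.zero_iff] at this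
      simp [this]
    have hv0 : P.val (a R₀) ≠ 0 := by simpa using ha
    rw [← Finset.add_sum_erase _ _ (Finset.mem_univ R₀), Valuation.map_add_eq_of_lt_left, h0]
    rw [h0]
    refine Valuation.map_sum_lt _ hv0 fun R hR => ?_
    rw [Algebra.smul_def, map_mul, hunr]
    calc P.val (a R) * R₀.1.val (e R) ≤ P.val (a R₀) * R₀.1.val (e R) :=
          mul_le_mul_left (hR₀ R) _
      _ < P.val (a R₀) * 1 :=
          mul_lt_mul_of_pos_left (he2 R R₀ (Finset.ne_of_mem_erase hR).symm) (zero_lt_iff.2 hv0)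
      _ = _ := mul_one _
  have hli : LinearIndependent F e := by
    rw [Fintype.linearIndependent_iff]
    intro a ha R
    obtain ⟨R₀, h1, h2⟩ := key a
    rw [ha, map_zero] at h2
    have := h1 R
    rwa [← h2, le_zero_iff, Valuation.zero_iff] at this
  let b := basisOfLinearIndependentOfCardEqFinrank hli (by rw [← hcard, Nat.card_eq_fintype_card])
  have hb : ∀ R, b R = e R := fun R => by simp [b]
  -- functions vanishing at all places over `P` have coordinates that vanish at `P`
  have hcoord : ∀ f : F', (∀ R : ι, R.1.val f < 1) →
      ∃ a : ι → F, (∀ R, P.val (a R) < 1) ∧ f = ∑ R, a R • b R := fun f hf => by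
    refine ⟨b.repr f, ?_, (b.sum_repr f).symm⟩
    obtain ⟨R₀, h1, h2⟩ := key (b.repr f)
    have h3 : ∑ R, b.repr f R • e R = f := by
      conv_rhs => rw [← b.sum_repr f]
      simp [hb]
    rw [h3] at h2
    exact fun R => (h1 R).trans_lt (h2 ▸ hf R₀)
  refine ⟨ι, inferInstance, inferInstance, b, fun R R' => ?_, ?_⟩
  · obtain ⟨a, ha, ha'⟩ := hcoord (b R * b R' - if R = R' then b R else 0) fun R₀ => by
      rw [hb, hb]
      split_ifs with h
      · subst h
        rw [show e R * e R - e R = (e R - 1) * e R by ring, map_mul]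
        by_cases h : R₀ = R
        · subst h
          exact mul_lt_one_of_lt_of_le (he1 _) (heR _).le
        · have h1 := he2 R R₀ h
          rw [mul_comm]
          refine mul_lt_one_of_lt_of_le h1 ?_
          exact Valuation.map_sub_le _ h1.le (by simp)
      · rw [sub_zero, map_mul]
        by_cases h' : R₀ = R
        · subst h'
          rw [heR, one_mul]
          exact he2 _ _ h
        · have h1 := he2 R R₀ h'
          refine mul_lt_one_of_lt_of_le h1 ?_
          by_cases h'' : R₀ = R'
          · subst h''
            exact (heR _).le
          · exact (he2 _ _ h'').le
    exact ⟨a, ha, by rw [← ha']; ring⟩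
  · obtain ⟨a, ha, ha'⟩ := hcoord (∑ R, b R - 1) fun R₀ => by
      rw [← Finset.add_sum_erase _ _ (Finset.mem_univ R₀), hb, add_sub_right_comm]
      refine Valuation.map_add_lt _ (he1 _) (Valuation.map_sum_lt _ one_ne_zero fun R hR => ?_)
      rw [hb]
      exact he2 _ _ (Finset.ne_of_mem_erase hR).symm
    exact ⟨a, ha, by rw [← ha']; ring⟩

end Splitting

end Place

/-! ### Base change of completely split places -/

namespace Place

section BaseChange

variable {k : Type u} {E : Type v} {E' : Type w} [Field k] [Field E] [Algebra k E] [Field E']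
  [Algebra k E']

/-- Suppose that `E'` is spanned over `E` by elements `c i` that are orthogonal idempotents with sum
one modulo the maximal ideal at the rational place `Q`. Then the places over `Q` are unramified and
rational: a place `R` over `Q` selects the index `i` with `c i ≡ 1`, and an integral combination of
the `c l` that vanishes at `R` is divisible by a local parameter at `Q` after multiplication
by `c i`. -/
theorem hasRamificationIdx_one_of_approx_idempotents {ι : Type*} [Fintype ι] [DecidableEq ι]
    (g : E →ₐ[k] E') {Q : Place k E} {R : Place k E'} (hR : LiesOver g Q R) (hQ : Q.IsRational)
    (c : ι → E') (hspan : ∀ x, ∃ u : ι → E, x = ∑ l, g (u l) * c l)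
    (hmul : ∀ i j, ∃ a : ι → E, (∀ l, Q.val (a l) < 1) ∧
      c i * c j = (if i = j then c i else 0) + ∑ l, g (a l) * c l)
    (hone : ∃ a : ι → E, (∀ l, Q.val (a l) < 1) ∧ ∑ i, c i = 1 + ∑ l, g (a l) * c l) :
    HasRamificationIdx g Q R 1 ∧ R.IsRational := by
  obtain ⟨n, hn⟩ := hR
  choose a ha hac using hmul
  obtain ⟨a₁, ha₁, hac₁⟩ := hone
  have hc1 : ∀ i, R.val (c i) ≤ 1 := by
    intro i
    obtain ⟨i₀, -, hi₀⟩ := Finset.exists_max_image Finset.univ (fun i => R.val (c i))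
      ⟨i, Finset.mem_univ i⟩
    refine (hi₀ i (Finset.mem_univ i)).trans ?_
    by_contra! hgt
    have h1 : R.val (c i₀ * c i₀) ≤ R.val (c i₀) := by
      rw [hac, if_pos rfl]
      refine Valuation.map_add_le _ le_rfl (Valuation.map_sum_le _ fun l hl => ?_)
      rw [map_mul]
      exact (mul_le_of_le_one_left' (hn.val_lt_one_iff.2 (ha _ _ l)).le).trans (hi₀ l hl)
    rw [map_mul] at h1
    have h2 := mul_lt_mul_of_pos_right hgt (zero_lt_one.trans hgt)
    rw [one_mul] at h2
    exact absurd h1 (not_le.2 h2)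
  have hsmall : ∀ a : ι → E, (∀ l, Q.val (a l) < 1) → R.val (∑ l, g (a l) * c l) < 1 :=
    fun a ha => Valuation.map_sum_lt _ one_ne_zero fun l _ => by
      rw [map_mul]
      exact mul_lt_one_of_lt_of_le (hn.val_lt_one_iff.2 (ha l)) (hc1 l)
  -- the index selected by `R`
  obtain ⟨i, hi⟩ : ∃ i, R.val (c i) = 1 := by
    by_contra! hcon
    have h1 : R.val (∑ i, c i) < 1 := Valuation.map_sum_lt _ one_ne_zero fun i _ =>
      lt_of_le_of_ne (hc1 i) (hcon i)
    have h2 : (1 : E') = ∑ i, c i - ∑ l, g (a₁ l) * c l := by rw [hac₁]; ring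
    have h3 := Valuation.map_sub_lt _ h1 (hsmall a₁ ha₁)
    rw [← h2, map_one] at h3
    exact lt_irrefl _ h3
  have hj : ∀ j ≠ i, R.val (c j) < 1 := fun j hji => by
    have h1 : R.val (c i * c j) < 1 := by
      rw [hac, if_neg hji.symm, zero_add]
      exact hsmall _ (ha i j)
    rwa [map_mul, hi, one_mul] at h1
  have hi' : R.val (c i - 1) < 1 := by
    have h1 : c i - 1 = ∑ l, g (a₁ l) * c l - ∑ j ∈ Finset.univ.erase i, c j := by
      have h2 := Finset.add_sum_erase Finset.univ c (Finset.mem_univ i)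
      rw [hac₁] at h2
      linear_combination h2
    rw [h1]
    exact Valuation.map_sub_lt _ (hsmall a₁ ha₁) (Valuation.map_sum_lt _ one_ne_zero fun j hj' =>
      hj j (Finset.ne_of_mem_erase hj'))
  obtain ⟨t, ht⟩ := Q.exists_isLocalParameter
  set τ := R.val (g t) with hτ
  have hτ1 : τ < 1 := hn.val_lt_one_iff.2 ht.val_lt_one
  have hgt0 : g t ≠ 0 := by simpa using ht.ne_zero
  have hτ0 : τ ≠ 0 := by
    rw [hτ, Valuation.ne_zero_iff]
    exact hgt0
  have hint : ∀ u : ι → E, (∀ l, Q.val (u l) ≤ 1) → R.val (∑ l, g (u l) * c l) ≤ 1 :=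
    fun u hu => Valuation.map_sum_le _ fun l _ => by
      rw [map_mul]
      exact mul_le_one' (hn.val_le_one_iff.2 (hu l)) (hc1 l)
  have hres : ∀ u : ι → E, (∀ l, Q.val (u l) ≤ 1) → R.val (∑ l, g (u l) * c l - g (u i)) < 1 := by
    intro u hu
    rw [← Finset.add_sum_erase _ _ (Finset.mem_univ i), add_sub_right_comm]
    refine Valuation.map_add_lt _ ?_ (Valuation.map_sum_lt _ one_ne_zero fun j hj' => ?_)
    · rw [show g (u i) * c i - g (u i) = (c i - 1) * g (u i) by ring, map_mul]
      exact mul_lt_one_of_lt_of_le hi' (hn.val_le_one_iff.2 (hu i))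
    · rw [map_mul, mul_comm]
      exact mul_lt_one_of_lt_of_le (hj j (Finset.ne_of_mem_erase hj')) (hn.val_le_one_iff.2 (hu j))
  have hdiv : ∀ u : ι → E, (∀ l, Q.val (u l) ≤ 1) → R.val (∑ l, g (u l) * c l) < 1 →
      ∃ u' : ι → E, (∀ l, Q.val (u' l) ≤ 1) ∧
        c i * ∑ l, g (u l) * c l = g t * ∑ l, g (u' l) * c l := by
    intro u hu hlt
    have hui : Q.val (u i) < 1 := by
      rw [← hn.val_lt_one_iff]
      have := Valuation.map_sub_lt _ hlt (hres u hu)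
      simpa using this
    let w : ι → E := fun m => (if m = i then u i else 0) + ∑ l, u l * a i l m
    have hw : ∀ m, Q.val (w m) < 1 := fun m => by
      refine Valuation.map_add_lt _ ?_ (Valuation.map_sum_lt _ one_ne_zero fun l _ => ?_)
      · split_ifs
        · exact hui
        · simp
      · rw [map_mul, mul_comm]
        exact mul_lt_one_of_lt_of_le (ha i l m) (hu l)
    choose u' hu' hwu using fun m => exists_eq_mul_of_val_lt_one ht (hw m)
    refine ⟨u', hu', ?_⟩
    have h1 : c i * ∑ l, g (u l) * c l = ∑ m, g (w m) * c m := by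
      have h2 : ∀ l, c i * (g (u l) * c l) =
          (if i = l then g (u l) * c i else 0) + ∑ m, g (u l * a i l m) * c m := fun l => by
        rw [show c i * (g (u l) * c l) = g (u l) * (c i * c l) by ring, hac, mul_add, mul_ite,
          mul_zero, Finset.mul_sum]
        simp only [map_mul, mul_assoc]
      rw [Finset.mul_sum]
      simp only [h2, w, map_add, map_sum, add_mul, Finset.sum_add_distrib, Finset.sum_mul]
      congr 1
      · rw [Finset.sum_ite_eq, if_pos (Finset.mem_univ i), Finset.sum_eq_single i]
        · simp
        · intro b _ hb
          simp [hb]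
        · simp
      · exact Finset.sum_comm
    rw [h1, Finset.mul_sum]
    refine Finset.sum_congr rfl fun m _ => ?_
    rw [hwu m, map_mul, mul_assoc]
  -- dividing repeatedly, an integral combination becomes a unit at `R`
  have hunit : ∀ (N : ℕ) (u : ι → E), (∀ l, Q.val (u l) ≤ 1) →
      τ ^ N ≤ R.val (∑ l, g (u l) * c l) →
      ∃ (s : ℕ) (u' : ι → E), (∀ l, Q.val (u' l) ≤ 1) ∧ R.val (∑ l, g (u' l) * c l) = 1 ∧
        c i ^ s * ∑ l, g (u l) * c l = g t ^ s * ∑ l, g (u' l) * c l := by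
    intro N
    induction N with
    | zero =>
      intro u hu hle
      exact ⟨0, u, hu, le_antisymm (hint u hu) (by simpa using hle), by simp⟩
    | succ N ih =>
      intro u hu hle
      rcases (hint u hu).lt_or_eq with hlt | heq
      · obtain ⟨u', hu', h1⟩ := hdiv u hu hlt
        have h2 := congrArg R.val h1
        rw [map_mul, map_mul, hi, one_mul, ← hτ] at h2
        rw [h2, pow_succ'] at hle
        obtain ⟨s, u'', hu'', h3, h4⟩ := ih u' hu' (le_of_mul_le_mul_left hle (zero_lt_iff.2 hτ0))
        refine ⟨s + 1, u'', hu'', h3, ?_⟩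
        rw [pow_succ, mul_assoc, h1, pow_succ', mul_assoc, ← h4]
        ring
      · exact ⟨0, u, hu, heq, by simp⟩
  have hQexp : ∀ u : ι → E, ∃ N : ℕ, ∀ l, Q.val (t ^ N * u l) ≤ 1 := by
    intro u
    obtain ⟨N, hN⟩ : ∃ N : ℕ, ∀ l, -Q.ord (u l) ≤ N := by
      refine ⟨∑ l, (Q.ord (u l)).natAbs, fun l => ?_⟩
      have h1 : (Q.ord (u l)).natAbs ≤ ∑ l, (Q.ord (u l)).natAbs :=
        Finset.single_le_sum (f := fun l => (Q.ord (u l)).natAbs) (fun _ _ => Nat.zero_le _)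
          (Finset.mem_univ l)
      omega
    refine ⟨N, fun l => ?_⟩
    rcases eq_or_ne (u l) 0 with h0 | h0
    · simp [h0]
    rw [map_mul, map_pow, ht, val_eq_exp h0, ← WithZero.exp_nsmul, ← WithZero.exp_add,
      ← WithZero.exp_zero, WithZero.exp_le_exp]
    have := hN l
    simp
    omega
  have hτexp : ∃ m : ℤ, 0 < m ∧ τ = WithZero.exp (-m) := by
    refine ⟨R.ord (g t), ?_, val_eq_exp hgt0⟩
    rw [hτ, val_eq_exp hgt0, ← WithZero.exp_zero, WithZero.exp_lt_exp] at hτ1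
    omega
  obtain ⟨m, hm, hτm⟩ := hτexp
  have hstruct : ∀ x : E', x ≠ 0 → ∃ (N s : ℕ) (u : ι → E), (∀ l, Q.val (u l) ≤ 1) ∧
      R.val (∑ l, g (u l) * c l) = 1 ∧
        c i ^ s * (g t ^ N * x) = g t ^ s * ∑ l, g (u l) * c l := by
    intro x hx
    obtain ⟨u, hu⟩ := hspan x
    obtain ⟨N, hN⟩ := hQexp u
    have h1 : g t ^ N * x = ∑ l, g (t ^ N * u l) * c l := by
      rw [hu, Finset.mul_sum]
      refine Finset.sum_congr rfl fun l _ => ?_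
      rw [map_mul, map_pow, mul_assoc]
    have h2 : g t ^ N * x ≠ 0 := mul_ne_zero (pow_ne_zero _ hgt0) hx
    obtain ⟨M, hM⟩ : ∃ M : ℕ, τ ^ M ≤ R.val (g t ^ N * x) := by
      refine ⟨(R.ord (g t ^ N * x)).natAbs, ?_⟩
      rw [val_eq_exp h2, hτm, ← WithZero.exp_nsmul, WithZero.exp_le_exp, nsmul_eq_mul]
      have h3 : R.ord (g t ^ N * x) ≤ (R.ord (g t ^ N * x)).natAbs := Int.le_natAbs
      nlinarith [Int.natCast_nonneg (R.ord (g t ^ N * x)).natAbs]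
    rw [h1] at hM
    obtain ⟨s, u', hu', h3, h4⟩ := hunit M _ hN hM
    exact ⟨N, s, u', hu', h3, by rw [h1, h4]⟩
  have hvalstruct : ∀ (x : E') (N s : ℕ) (u : ι → E), R.val (∑ l, g (u l) * c l) = 1 →
      c i ^ s * (g t ^ N * x) = g t ^ s * ∑ l, g (u l) * c l → τ ^ N * R.val x = τ ^ s := by
    intro x N s u h1 h2
    have h3 := congrArg R.val h2
    rwa [map_mul, map_mul, map_mul, map_pow, map_pow, map_pow, hi, h1, one_pow, one_mul,
      mul_one] at h3
  constructor
  · have hm1 : m = 1 := by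
      obtain ⟨x, hx⟩ := R.exists_isLocalParameter
      obtain ⟨N, s, u, hu, h1, h2⟩ := hstruct x hx.ne_zero
      have h3 := hvalstruct x N s u h1 h2
      rw [hx, hτm, ← WithZero.exp_nsmul, ← WithZero.exp_nsmul, ← WithZero.exp_add,
        WithZero.exp_inj, nsmul_eq_mul, nsmul_eq_mul] at h3
      have h4 : m * ((s : ℤ) - N) = 1 := by linarith
      rcases Int.eq_one_or_neg_one_of_mul_eq_one h4 with h | h <;> omega
    have hn1 : n = 1 := by
      have h1 := hn t
      rw [← hτ, hτm, hm1, ht, ← WithZero.exp_nsmul, WithZero.exp_inj] at h1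
      simp at h1
      omega
    exact hn1 ▸ hn
  · intro x hx
    rcases hx.lt_or_eq with hlt | heq
    · exact ⟨0, by simpa using hlt⟩
    have hx0 : x ≠ 0 := by
      rintro rfl
      simp at heq
    obtain ⟨N, s, u, hu, h1, h2⟩ := hstruct x hx0
    have h3 := hvalstruct x N s u h1 h2
    rw [heq, mul_one, hτm, ← WithZero.exp_nsmul, ← WithZero.exp_nsmul, WithZero.exp_inj,
      nsmul_eq_mul, nsmul_eq_mul] at h3
    have hNs : N = s := by
      have : (N : ℤ) = s := mul_right_cancel₀ (neg_ne_zero.2 hm.ne') h3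
      exact_mod_cast this
    have h4 : c i ^ s * x = ∑ l, g (u l) * c l := by
      apply mul_left_cancel₀ (pow_ne_zero s hgt0)
      rw [← h2, hNs]
      ring
    obtain ⟨κ, hκ⟩ := hQ (u i) (hu i)
    have h5 : R.val (c i ^ s - 1) < 1 := by
      rw [← geom_sum_mul, mul_comm, map_mul]
      refine mul_lt_one_of_lt_of_le hi' (Valuation.map_sum_le _ fun j _ => ?_)
      rw [map_pow, hi, one_pow]
    refine ⟨κ, ?_⟩
    have h6 : R.val (g (u i) - algebraMap k E' κ) < 1 := by
      have := hn.val_lt_one_iff.2 hκ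
      simpa using this
    have h7 : x - algebraMap k E' κ = (∑ l, g (u l) * c l - g (u i)) +
        (g (u i) - algebraMap k E' κ) - (c i ^ s - 1) * x := by
      rw [← h4]
      ring
    rw [h7]
    refine Valuation.map_sub_lt _ (Valuation.map_add_lt _ (hres u hu) h6) ?_
    rw [map_mul, heq, mul_one]
    exact h5

end BaseChange

end Place

/-! ### Counting places and rational points -/

namespace Place

section RationalFunctionField

variable {k : Type u} {F : Type v} [Field k] [Field F] [Algebra k F]

theorem val_aeval_of_one_lt (P : Place k F) {z : F} (hz : 1 < P.val z) {r : Polynomial k}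
    (hr : r ≠ 0) : P.val (Polynomial.aeval z r) = P.val z ^ r.natDegree := by
  have hlead : P.val (r.coeff r.natDegree • z ^ r.natDegree) = P.val z ^ r.natDegree := by
    rw [Algebra.smul_def, map_mul, map_pow, P.map_const _ (by simpa using hr), one_mul]
  have hpos : 0 < P.val z := zero_lt_one.trans hz
  rw [Polynomial.aeval_eq_sum_range, Finset.sum_range_succ, Valuation.map_add_eq_of_lt_right, hlead]
  rw [hlead]
  refine Valuation.map_sum_lt _ (pow_pos hpos _).ne' fun i hi => ?_
  rw [Algebra.smul_def, map_mul, map_pow]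
  exact (mul_le_of_le_one_left' (P.val_const_le _)).trans_lt
    (pow_lt_pow_right₀ hz (Finset.mem_range.1 hi))

/-- The rational function field `k(z)` has only one place with a pole of `z`. -/
theorem eq_of_one_lt_val {P P' : Place k F} {z : F}
    (hspan : ∀ f : F, ∃ r s : Polynomial k, f = Polynomial.aeval z r / Polynomial.aeval z s)
    (hz : 1 < P.val z) (hz' : 1 < P'.val z) : P = P' := by
  refine eq_of_le_one fun f hf => ?_
  obtain ⟨r, s, rfl⟩ := hspan f
  rcases eq_or_ne r 0 with rfl | hr
  · simp
  rcases eq_or_ne s 0 with rfl | hs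
  · simp
  have key : ∀ Q : Place k F, 1 < Q.val z →
      (Q.val (Polynomial.aeval z r / Polynomial.aeval z s) ≤ 1 ↔ r.natDegree ≤ s.natDegree) := by
    intro Q hQ
    rw [map_div₀, val_aeval_of_one_lt Q hQ hr, val_aeval_of_one_lt Q hQ hs,
      div_le_one₀ (pow_pos (zero_lt_one.trans hQ) _), pow_le_pow_iff_right₀ hQ]
  exact (key P' hz').2 ((key P hz).1 hf)

end RationalFunctionField

section Counting

variable {k : Type u} {E : Type v} {E' : Type w} [Field k] [Field E] [Algebra k E] [Field E']
  [Algebra k E']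

theorem LiesOver.isRational {g : E →ₐ[k] E'} {P : Place k E} {R : Place k E'} (h : LiesOver g P R)
    (hR : R.IsRational) : P.IsRational := fun f hf => by
  obtain ⟨n, hn⟩ := h
  obtain ⟨c, hc⟩ := hR (g f) (hn.val_le_one_iff.2 hf)
  refine ⟨c, hn.val_lt_one_iff.1 ?_⟩
  rwa [map_sub, AlgHom.commutes]

/-- A curve over a finite field has finitely many rational points. -/
theorem _root_.SplittingTower.IsCurve.finite_rational [Finite k] (hE : IsCurve k E) :
    Finite {P : Place k E // P.IsRational} := by
  obtain ⟨x, hx, hfin, hsep⟩ := hE.exists_separating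
  set F := IntermediateField.adjoin k {x}
  have key : ∀ z : E, IntermediateField.adjoin k {z} = F →
      Set.Finite {R : Place k E | 1 < R.val z} := by
    intro z hz
    rcases Set.eq_empty_or_nonempty {R : Place k E | 1 < R.val z} with h0 | ⟨R₀, hR₀⟩
    · rw [h0]
      exact Set.finite_empty
    have hzF : z ∈ F := hz ▸ IntermediateField.mem_adjoin_simple_self k z
    let z' : F := ⟨z, hzF⟩
    have hspan : ∀ f : F, ∃ r s : Polynomial k,
        f = Polynomial.aeval z' r / Polynomial.aeval z' s := fun f => by
      obtain ⟨r, s, hrs⟩ := (IntermediateField.mem_adjoin_simple_iff k (f : E)).1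
        (by rw [hz]; exact f.2)
      refine ⟨r, s, Subtype.ext ?_⟩
      rw [hrs]
      have h1 : ∀ q : Polynomial k, ((Polynomial.aeval z' q : F) : E) = Polynomial.aeval z q :=
        fun q => (Polynomial.aeval_algHom_apply F.val z' q).symm
      rw [← h1, ← h1]
      rfl
    have hbelow : ∀ {R : Place k E} {P : Place k F},
        LiesOver (IsScalarTower.toAlgHom k F E) P R → 1 < R.val z → 1 < P.val z' := by
      rintro R P ⟨n, hn⟩ hRz
      rw [← not_le, ← hn.val_le_one_iff, not_le]
      exact hRz
    obtain ⟨P₀, hP₀⟩ := exists_liesOver_of_isIntegral (F := F) R₀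
    have hfinite : Set.Finite {R : Place k E | LiesOver (IsScalarTower.toAlgHom k F E) P₀ R} :=
      (placesOver (F' := E) P₀).1
    refine hfinite.subset fun R hR => ?_
    obtain ⟨P, hP⟩ := exists_liesOver_of_isIntegral (F := F) R
    have : P = P₀ := eq_of_one_lt_val hspan (hbelow hP hR) (hbelow hP₀ hR₀)
    exact this ▸ hP
  have hx' : ∀ c : k, x - algebraMap k E c ≠ 0 := fun c h0 =>
    hx ((sub_eq_zero.1 h0) ▸ isAlgebraic_algebraMap c)
  have hadj : ∀ c : k, IntermediateField.adjoin k {(x - algebraMap k E c)⁻¹} = F := fun c => by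
    apply le_antisymm
    · rw [IntermediateField.adjoin_simple_le_iff]
      exact inv_mem (sub_mem (IntermediateField.mem_adjoin_simple_self k x)
        (IntermediateField.algebraMap_mem _ c))
    · rw [IntermediateField.adjoin_simple_le_iff]
      have h1 := inv_mem (IntermediateField.mem_adjoin_simple_self k (x - algebraMap k E c)⁻¹)
      have h2 := add_mem h1 (IntermediateField.algebraMap_mem
        (IntermediateField.adjoin k {(x - algebraMap k E c)⁻¹}) c)
      simpa using h2
  suffices h : Set.Finite {P : Place k E | P.IsRational} from h
  refine ((key x rfl).union (Set.finite_iUnion fun c : k => key _ (hadj c))).subset fun R hR => ?_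
  rcases lt_or_ge 1 (R.val x) with h | h
  · exact Or.inl h
  · obtain ⟨c, hc⟩ := hR x h
    refine Or.inr (Set.mem_iUnion.2 ⟨c, ?_⟩)
    change 1 < R.val (x - algebraMap k E c)⁻¹
    rw [map_inv₀]
    exact (one_lt_inv₀ (zero_lt_iff.2 (by simpa using hx' c))).2 hc

variable [Algebra E E'] [IsScalarTower k E E'] [FiniteDimensional E E'] [Algebra.IsSeparable E E']

/-- There are at most `[E' : E]` times as many rational points on the upper curve. -/
theorem numRationalPoints_le [Finite {P : Place k E // P.IsRational}] :
    Finite {R : Place k E' // R.IsRational} ∧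
      numRationalPoints k E' ≤ Module.finrank E E' * numRationalPoints k E := by
  have hfin : ∀ P : Place k E, Finite {R : Place k E' //
      LiesOver (IsScalarTower.toAlgHom k E E') P R} := fun P => (placesOver P).1
  choose b hb using fun R : Place k E' => exists_liesOver_of_isIntegral (F := E) R
  let f : {R : Place k E' // R.IsRational} → Σ P : {P : Place k E // P.IsRational},
      {R : Place k E' // LiesOver (IsScalarTower.toAlgHom k E E') P.1 R} :=
    fun R => ⟨⟨b R, (hb R).isRational R.2⟩, ⟨R, hb R⟩⟩
  have hf : Function.Injective f := fun R R' h => by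
    have h1 : ∀ S S' : Σ P : {P : Place k E // P.IsRational},
      {R : Place k E' // LiesOver (IsScalarTower.toAlgHom k E E') P.1 R}, S = S' →
        S.2.1 = S'.2.1 := by
      rintro S _ rfl
      rfl
    exact Subtype.ext (h1 _ _ h)
  refine ⟨Finite.of_injective f hf, (Nat.card_le_card_of_injective f hf).trans ?_⟩
  let _ := Fintype.ofFinite {P : Place k E // P.IsRational}
  rw [Nat.card_sigma, numRationalPoints, Nat.card_eq_fintype_card, mul_comm]
  exact Finset.sum_le_card_nsmul _ _ _ fun P _ => (placesOver P.1).2.1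

/-- Over a finite set `T` of completely split places there are `[E' : E] · #T` places. -/
theorem ncard_liesOver_of_splitsCompletely {T : Set (Place k E)} (hT : T.Finite)
    (hsplit : ∀ P ∈ T, P.SplitsCompletely E') :
    {R : Place k E' | ∃ P ∈ T, LiesOver (IsScalarTower.toAlgHom k E E') P R}.Finite ∧
      {R : Place k E' | ∃ P ∈ T, LiesOver (IsScalarTower.toAlgHom k E E') P R}.ncard =
        Module.finrank E E' * T.ncard := by
  have hfin : ∀ P : Place k E, Finite {R : Place k E' //
      LiesOver (IsScalarTower.toAlgHom k E E') P R} := fun P => (placesOver P).1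
  have : Finite T := hT
  let f : (Σ P : T, {R : Place k E' // LiesOver (IsScalarTower.toAlgHom k E E') P.1 R}) →
      {R : Place k E' | ∃ P ∈ T, LiesOver (IsScalarTower.toAlgHom k E E') P R} :=
    fun S => ⟨S.2.1, S.1.1, S.1.2, S.2.2⟩
  have hf : Function.Bijective f := by
    constructor
    · rintro ⟨⟨P, hP⟩, ⟨R, hR⟩⟩ ⟨⟨P', hP'⟩, ⟨R', hR'⟩⟩ h
      have h1 : R = R' := congrArg Subtype.val h
      subst h1
      have h2 : P = P' := LiesOver.unique hR hR'
      subst h2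
      rfl
    · rintro ⟨R, P, hP, hR⟩
      exact ⟨⟨⟨P, hP⟩, ⟨R, hR⟩⟩, rfl⟩
  refine ⟨Set.finite_coe_iff.1 (Finite.of_surjective f hf.2), ?_⟩
  rw [← Nat.card_coe_set_eq, ← Nat.card_eq_of_bijective f hf]
  let _ := Fintype.ofFinite T
  rw [Nat.card_sigma, ← Nat.card_coe_set_eq T, Nat.card_eq_fintype_card, mul_comm,
    Finset.sum_congr rfl fun P _ => (placesOver P.1).2.2.2.1 (hsplit P.1 P.2), Finset.sum_const,
    smul_eq_mul, Finset.card_univ]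

end Counting

end Place

/-! ### One step of the tower -/

namespace Place

section FibreProduct

variable {k : Type u} {K : Type v} {L : Type w} {E : Type*} {E' : Type*} [Field k] [Field K]
  [Algebra k K] [Field L] [Algebra k L] [Field E] [Algebra k E] [Field E'] [Algebra k E']
  [Algebra K L] [IsScalarTower k K L] [FiniteDimensional K L] [Algebra.IsSeparable K L]
  [Algebra K E] [IsScalarTower k K E] [Algebra E E'] [IsScalarTower k E E']

/-- Complete splitting is preserved under base change: if `P` splits completely in `L / K`, and
`E'` is the compositum of `E` and `L` over `K`, then the rational places of `E` over `P` split
completely in `E' / E`. -/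
theorem SplitsCompletely.of_liesOver {P : Place k K} (hP : P.SplitsCompletely L)
    (j : L →ₐ[k] E')
    (hcomm : ∀ x : K, algebraMap E E' (algebraMap K E x) = j (algebraMap K L x))
    (hgen : ∀ y : E', ∃ s : Finset (E × L), y = ∑ q ∈ s, algebraMap E E' q.1 * j q.2)
    {Q : Place k E} (hQP : LiesOver (IsScalarTower.toAlgHom k K E) P Q) (hQ : Q.IsRational) :
    Q.SplitsCompletely E' := by
  obtain ⟨ι, _, _, b, hmul, a₁, ha₁, hone⟩ := hP.exists_basis
  obtain ⟨m, hm⟩ := hQP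
  have hsmall : ∀ x : K, P.val x < 1 → Q.val (algebraMap K E x) < 1 := fun x hx =>
    hm.val_lt_one_iff.2 hx
  have hj : ∀ (x : K) (y : L), j (x • y) = algebraMap E E' (algebraMap K E x) * j y :=
    fun x y => by rw [Algebra.smul_def, map_mul, hcomm]
  intro R n hn
  have h := hasRamificationIdx_one_of_approx_idempotents (IsScalarTower.toAlgHom k E E') ⟨n, hn⟩ hQ
    (fun i => j (b i)) ?_ ?_ ?_
  · exact ⟨hn.unique h.1, h.2⟩
  · intro y
    obtain ⟨s, rfl⟩ := hgen y
    refine ⟨fun l => ∑ q ∈ s, q.1 * algebraMap K E (b.repr q.2 l), ?_⟩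
    change _ = ∑ l, algebraMap E E' (∑ q ∈ s, q.1 * algebraMap K E (b.repr q.2 l)) * j (b l)
    simp only [map_sum, Finset.sum_mul]
    rw [Finset.sum_comm]
    refine Finset.sum_congr rfl fun q _ => ?_
    conv_lhs => rw [← b.sum_repr q.2]
    rw [map_sum, Finset.mul_sum]
    refine Finset.sum_congr rfl fun l _ => ?_
    rw [hj, map_mul, mul_assoc]
  · intro i i'
    obtain ⟨a, ha, hab⟩ := hmul i i'
    refine ⟨fun l => algebraMap K E (a l), fun l => hsmall _ (ha l), ?_⟩
    change j (b i) * j (b i') = (if i = i' then j (b i) else 0) +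
      ∑ l, algebraMap E E' (algebraMap K E (a l)) * j (b l)
    rw [← map_mul, hab, map_add, map_sum, apply_ite j, map_zero]
    simp only [hj]
  · refine ⟨fun l => algebraMap K E (a₁ l), fun l => hsmall _ (ha₁ l), ?_⟩
    change ∑ i, j (b i) = 1 + ∑ l, algebraMap E E' (algebraMap K E (a₁ l)) * j (b l)
    rw [← map_sum, hone, map_add, map_sum, map_one]
    simp only [hj]

end FibreProduct

end Place

section Stage

variable {k : Type u} {K : Type v} {L : Type w} [Field k] [Field K] [Algebra k K] [Field L]
  [Algebra k L]

/-- The points over `T` of a curve with two maps `x_0` and `x_m` to the curve with function field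
`L`: they are unramified under `x_0` and rational, `x_m` maps them into `T`, and there are `d` of
them. -/
structure SplitsOver {E : Type*} [CommRing E] [Algebra k E] (T : Set (Place k L)) (d : ℕ)
    (first last : L →ₐ[k] E) : Prop where
  unramified : ∀ Q ∈ T, ∀ R, Place.LiesOver first Q R →
    Place.HasRamificationIdx first Q R 1 ∧ R.IsRational ∧ ∃ Q' ∈ T, Place.LiesOver last Q' R
  finite : {R | ∃ Q ∈ T, Place.LiesOver first Q R}.Finite
  ncard : {R | ∃ Q ∈ T, Place.LiesOver first Q R}.ncard = d

theorem SplitsOver.refl {T : Set (Place k L)} (hfin : T.Finite) (hrat : ∀ Q ∈ T, Q.IsRational) :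
    SplitsOver T T.ncard (AlgHom.id k L) (AlgHom.id k L) := by
  have hid : ∀ Q : Place k L, Place.HasRamificationIdx (AlgHom.id k L) Q Q 1 := fun Q f => by simp
  have heq : ∀ {Q R : Place k L}, Place.LiesOver (AlgHom.id k L) Q R → Q = R := fun h =>
    h.unique ⟨1, hid _⟩
  have hset : {R | ∃ Q ∈ T, Place.LiesOver (AlgHom.id k L) Q R} = T := by
    ext R
    constructor
    · rintro ⟨Q, hQ, h⟩
      exact heq h ▸ hQ
    · exact fun hR => ⟨R, hR, 1, hid R⟩
  refine ⟨fun Q hQ R hR => ?_, by rwa [hset], by rw [hset]⟩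
  obtain rfl := heq hR
  exact ⟨hid _, hrat _ hQ, Q, hQ, 1, hid _⟩

theorem SplitsOver.step {E E' : Type*} [Field E] [Algebra k E] [Field E'] [Algebra k E']
    [Algebra E E'] [IsScalarTower k E E'] [FiniteDimensional E E'] [Algebra.IsSeparable E E']
    {T : Set (Place k L)} {d : ℕ} {first last : L →ₐ[k] E} (hE : SplitsOver T d first last)
    {g h : K →ₐ[k] L} (hgsep : IsSeparableCover g) (hhsep : IsSeparableCover h)
    (hL : IsCurve k L)
    (hT : ∀ Q ∈ T, ∀ P, Place.LiesOver g P Q → ∀ Q' n, Place.HasRamificationIdx h P Q' n →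
      n = 1 ∧ Q'.IsRational ∧ Q' ∈ T)
    {last' : L →ₐ[k] E'} (hcomm : ∀ x : K, algebraMap E E' (last (g x)) = last' (h x))
    (hgen : ∀ y : E', ∃ s : Finset (E × L), y = ∑ q ∈ s, algebraMap E E' q.1 * last' q.2) :
    SplitsOver T (Module.finrank E E' * d) ((IsScalarTower.toAlgHom k E E').comp first) last' := by
  -- the points over `T` on the lower curve split completely
  have hsplit : ∀ R : Place k E, (∃ Q ∈ T, Place.LiesOver first Q R) →
      R.IsRational ∧ R.SplitsCompletely E' ∧
      ∃ P : Place k K, Place.LiesOver (last.comp g) P R ∧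
        ∀ Q' n, Place.HasRamificationIdx h P Q' n → Q' ∈ T := by
    rintro R ⟨Q, hQ, hQR⟩
    obtain ⟨-, hRrat, Q', hQ', hQ'R⟩ := hE.unramified Q hQ R hQR
    obtain ⟨P, hPQ'⟩ : ∃ P, Place.LiesOver g P Q' := by
      let _ : Algebra K L := g.toRingHom.toAlgebra
      have : IsScalarTower k K L := IsScalarTower.of_algebraMap_eq fun c => (g.commutes c).symm
      have : Algebra.IsSeparable K L := hgsep.algebra_isSeparable
      exact Place.exists_liesOver_of_isIntegral (F := K) Q'
    have hPR : Place.LiesOver (last.comp g) P R := by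
      obtain ⟨n, hn⟩ := hPQ'
      obtain ⟨n', hn'⟩ := hQ'R
      exact ⟨n * n', fun f => by rw [pow_mul, ← hn f, ← hn']; rfl⟩
    have hTP := hT Q' hQ' P hPQ'
    refine ⟨hRrat, ?_, P, hPR, fun Q'' n hn => (hTP Q'' n hn).2.2⟩
    let _ : Algebra K L := h.toRingHom.toAlgebra
    have : IsScalarTower k K L := IsScalarTower.of_algebraMap_eq fun c => (h.commutes c).symm
    have : Algebra.IsSeparable K L := hhsep.algebra_isSeparable
    have : FiniteDimensional K L := hhsep.algebra_finite hL
    let _ : Algebra K E := (last.comp g).toRingHom.toAlgebra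
    have : IsScalarTower k K E :=
      IsScalarTower.of_algebraMap_eq fun c => ((last.comp g).commutes c).symm
    have hP : P.SplitsCompletely L := fun Q'' n hn =>
      ⟨(hTP Q'' n hn).1, (hTP Q'' n hn).2.1⟩
    exact hP.of_liesOver last' hcomm hgen hPR hRrat
  have hset : {R' | ∃ Q ∈ T, Place.LiesOver ((IsScalarTower.toAlgHom k E E').comp first) Q R'} =
      {R' | ∃ R ∈ {R | ∃ Q ∈ T, Place.LiesOver first Q R},
        Place.LiesOver (IsScalarTower.toAlgHom k E E') R R'} := by
    ext R'
    constructor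
    · rintro ⟨Q, hQ, hQR'⟩
      obtain ⟨R, hRR', hQR⟩ := Place.exists_liesOver_of_liesOver_comp _ _ hQR'
      exact ⟨R, ⟨Q, hQ, hQR⟩, hRR'⟩
    · rintro ⟨R, ⟨Q, hQ, n, hn⟩, n', hn'⟩
      exact ⟨Q, hQ, n * n', fun f => by rw [pow_mul, ← hn f, ← hn']; rfl⟩
  have hcount := Place.ncard_liesOver_of_splitsCompletely (E' := E') hE.finite
    fun R hR => (hsplit R hR).2.1
  refine ⟨fun Q hQ R' hQR' => ?_, by rw [hset]; exact hcount.1, by rw [hset, hcount.2, hE.ncard]⟩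
  obtain ⟨R, ⟨n, hn⟩, hQR⟩ := Place.exists_liesOver_of_liesOver_comp _ _ hQR'
  obtain ⟨-, hRs, P, hPR, hPT⟩ := hsplit R ⟨Q, hQ, hQR⟩
  obtain ⟨rfl, hR'rat⟩ := hRs R' n hn
  refine ⟨fun f => ?_, hR'rat, ?_⟩
  · rw [pow_one, ← pow_one (Q.val f), ← (hE.unramified Q hQ R hQR).1 f, ← pow_one (R.val (first f))]
    exact hn (first f)
  · have hPR' : Place.LiesOver (last'.comp h) P R' := by
      obtain ⟨m, hm⟩ := hPR
      refine ⟨m * 1, fun f => ?_⟩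
      rw [pow_mul, ← hm f, ← hn]
      exact congrArg R'.val (hcomm f).symm
    obtain ⟨Q'', hQ''R', n'', hn''⟩ := Place.exists_liesOver_of_liesOver_comp _ _ hPR'
    exact ⟨Q'', hPT Q'' n'' hn'', hQ''R'⟩

theorem GeomIntegral.isDomain {R : Type*} [CommRing R] [Algebra k R] (h : GeomIntegral k R) :
    IsDomain R := by
  have : IsDomain (AlgebraicClosure k ⊗[k] R) := h
  exact Function.Injective.isDomain
    (Algebra.TensorProduct.includeRight : R →ₐ[k] AlgebraicClosure k ⊗[k] R)
    (Algebra.TensorProduct.includeRight_injective (algebraMap k (AlgebraicClosure k)).injective)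

/-- The extension of rings of functions given by one step of the tower is the base change of the
finite separable extension `L / K` given by `h`. -/
theorem TowerStage.next_spec (g h : K →ₐ[k] L) (hhsep : IsSeparableCover h) (hL : IsCurve k L)
    (A : TowerStage k L) (hA : IsField A.ring) (hdom : IsDomain (A.next g h).ring) :
    IsField (A.next g h).ring ∧
    ∃ (_ : Algebra A.ring (A.next g h).ring) (_ : IsScalarTower k A.ring (A.next g h).ring),
      Module.Finite A.ring (A.next g h).ring ∧
      Module.finrank A.ring (A.next g h).ring = coverDegree h ∧
      Algebra.FormallyEtale A.ring (A.next g h).ring ∧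
      (A.next g h).first = (IsScalarTower.toAlgHom k A.ring (A.next g h).ring).comp A.first ∧
      (∀ x : K, algebraMap A.ring (A.next g h).ring (A.last (g x)) = (A.next g h).last (h x)) ∧
      ∀ y : (A.next g h).ring, ∃ s : Finset (A.ring × L),
        y = ∑ q ∈ s, algebraMap A.ring (A.next g h).ring q.1 * (A.next g h).last q.2 := by
  have hdeg := coverDegree_eq_finrank h
  let _ : Algebra K A.ring := (A.last.comp g).toRingHom.toAlgebra
  let _ : Algebra K L := h.toRingHom.toAlgebra
  have : IsScalarTower k K A.ring :=
    IsScalarTower.of_algebraMap_eq fun c => ((A.last.comp g).commutes c).symm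
  have : IsScalarTower k K L := IsScalarTower.of_algebraMap_eq fun c => (h.commutes c).symm
  have : Algebra.IsSeparable K L := hhsep.algebra_isSeparable
  have : FiniteDimensional K L := hhsep.algebra_finite hL
  have : Algebra.FormallyEtale K L := Algebra.FormallyEtale.of_isSeparable K L
  have hdom' : IsDomain (A.ring ⊗[K] L) := hdom
  have : Nontrivial A.ring := hA.nontrivial
  change IsField (A.ring ⊗[K] L) ∧ _
  refine ⟨?_, (inferInstance : Algebra A.ring (A.ring ⊗[K] L)),
    (inferInstance : IsScalarTower k A.ring (A.ring ⊗[K] L)),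
    (inferInstance : Module.Finite A.ring (A.ring ⊗[K] L)), ?_,
    (inferInstance : Algebra.FormallyEtale A.ring (A.ring ⊗[K] L)), rfl, fun x => ?_, fun y => ?_⟩
  · exact isField_of_isIntegral_of_isField' hA
  · rw [hdeg]
    exact Module.finrank_baseChange
  · change A.last (g x) ⊗ₜ[K] (1 : L) = (1 : A.ring) ⊗ₜ[K] h x
    have h1 : A.last (g x) = x • (1 : A.ring) := Algebra.algebraMap_eq_smul_one x
    have h2 : h x = x • (1 : L) := Algebra.algebraMap_eq_smul_one x
    rw [h1, h2, TensorProduct.smul_tmul]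
  · obtain ⟨s, hs⟩ := TensorProduct.exists_finset (R := K) (M := A.ring) (N := L) y
    refine ⟨s, hs.trans (Finset.sum_congr rfl fun q _ => ?_)⟩
    change q.1 ⊗ₜ[K] q.2 = (q.1 ⊗ₜ[K] (1 : L)) * ((1 : A.ring) ⊗ₜ[K] q.2)
    rw [Algebra.TensorProduct.tmul_mul_tmul, mul_one, one_mul]

end Stage

/-! ### The tower over the set `𝔗` -/

section Tower

variable {k : Type u} {K : Type v} {L : Type w} [Field k] [Field K] [Algebra k K] [Field L]
  [Algebra k L]

theorem SplitsOver.step_of_isField {E E' : Type*} [instE : CommRing E] [Algebra k E]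
    [instE' : CommRing E'] [Algebra k E'] (hE : IsField E) (hE' : IsField E') [Algebra E E']
    [IsScalarTower k E E'] [Module.Finite E E'] [Algebra.FormallyEtale E E']
    (hfin : Finite {R : Place k E // R.IsRational})
    {T : Set (Place k L)} {d : ℕ} {first last : L →ₐ[k] E} (hS : SplitsOver T d first last)
    {g h : K →ₐ[k] L} (hgsep : IsSeparableCover g) (hhsep : IsSeparableCover h)
    (hL : IsCurve k L)
    (hT : ∀ Q ∈ T, ∀ P, Place.LiesOver g P Q → ∀ Q' n, Place.HasRamificationIdx h P Q' n →
      n = 1 ∧ Q'.IsRational ∧ Q' ∈ T)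
    {last' : L →ₐ[k] E'} (hcomm : ∀ x : K, algebraMap E E' (last (g x)) = last' (h x))
    (hgen : ∀ y : E', ∃ s : Finset (E × L), y = ∑ q ∈ s, algebraMap E E' q.1 * last' q.2) :
    Finite {R : Place k E' // R.IsRational} ∧
      SplitsOver T (Module.finrank E E' * d) ((IsScalarTower.toAlgHom k E E').comp first) last' ∧
      numRationalPoints k E' ≤ Module.finrank E E' * numRationalPoints k E := by
  obtain ⟨F, rfl⟩ : ∃ F : Field E, F.toCommRing = instE := ⟨hE.toField, rfl⟩
  obtain ⟨F', rfl⟩ : ∃ F' : Field E', F'.toCommRing = instE' := ⟨hE'.toField, rfl⟩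
  have : Algebra.IsSeparable E E' := (Algebra.FormallyEtale.iff_isSeparable E E').1 inferInstance
  obtain ⟨h1, h2⟩ := Place.numRationalPoints_le (k := k) (E := E) (E' := E')
  exact ⟨h1, hS.step hgsep hhsep hL hT hcomm hgen, h2⟩

/-- The properties of the stages of the tower over a set `T` of points that is closed under the
correspondence `h⁻¹ ∘ g` and consists of rational points at which `h` is unramified. -/
theorem tower_spec (g h : K →ₐ[k] L) [Finite k] (hgsep : IsSeparableCover g)
    (hhsep : IsSeparableCover h) (hL : IsCurve k L)
    (hb : ∀ m : ℕ, GeomIntegral k (tower g h m).ring) {T : Set (Place k L)} (hTfin : T.Finite)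
    (hTrat : ∀ Q ∈ T, Q.IsRational)
    (hT : ∀ Q ∈ T, ∀ P, Place.LiesOver g P Q → ∀ Q' n, Place.HasRamificationIdx h P Q' n →
      n = 1 ∧ Q'.IsRational ∧ Q' ∈ T) (m : ℕ) :
    IsField (tower g h m).ring ∧ Finite {R : Place k (tower g h m).ring // R.IsRational} ∧
      SplitsOver T (coverDegree h ^ m * T.ncard) (tower g h m).first (tower g h m).last ∧
      numRationalPoints k (tower g h (m + 1)).ring ≤
        coverDegree h * numRationalPoints k (tower g h m).ring := by
  have step : ∀ m, IsField (tower g h m).ring →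
      Finite {R : Place k (tower g h m).ring // R.IsRational} →
      SplitsOver T (coverDegree h ^ m * T.ncard) (tower g h m).first (tower g h m).last →
      IsField (tower g h (m + 1)).ring ∧
        Finite {R : Place k (tower g h (m + 1)).ring // R.IsRational} ∧
        SplitsOver T (coverDegree h ^ (m + 1) * T.ncard) (tower g h (m + 1)).first
          (tower g h (m + 1)).last ∧
        numRationalPoints k (tower g h (m + 1)).ring ≤
          coverDegree h * numRationalPoints k (tower g h m).ring := by
    intro m h1 h2 h3
    obtain ⟨hF, i₁, i₂, hmf, hrank, het, hfirst, hcomm, hgen⟩ :=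
      TowerStage.next_spec g h hhsep hL (tower g h m) h1 (hb (m + 1)).isDomain
    have h4 := SplitsOver.step_of_isField h1 hF h2 h3 hgsep hhsep hL hT hcomm hgen
    rw [← hfirst, hrank, ← mul_assoc, ← pow_succ'] at h4
    exact ⟨hF, h4⟩
  have main : ∀ m, IsField (tower g h m).ring ∧
      Finite {R : Place k (tower g h m).ring // R.IsRational} ∧
      SplitsOver T (coverDegree h ^ m * T.ncard) (tower g h m).first (tower g h m).last := by
    intro m
    induction m with
    | zero =>
      refine ⟨Field.toIsField L, hL.finite_rational, ?_⟩
      rw [pow_zero, one_mul]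
      exact SplitsOver.refl hTfin hTrat
    | succ m ih =>
      obtain ⟨h1, h2, h3, -⟩ := step m ih.1 ih.2.1 ih.2.2
      exact ⟨h1, h2, h3⟩
  obtain ⟨h1, h2, h3⟩ := main m
  exact ⟨h1, h2, h3, (step m h1 h2 h3).2.2.2⟩

end Tower

section Adapted

variable {k : Type u} [Field k] [PerfectField k] (p : ℕ) [Fact p.Prime] [CharP k p]
  {K : Type v} {L : Type w} [Field K] [Algebra k K] [Field L] [Algebra k L]

/-- The set `𝔗` is closed under the correspondence `h⁻¹ ∘ g`, and `h` is unramified there. -/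
theorem DiffEq.splitSet_closed (hL : IsCurve k L) (E : DiffEq.{u, v, x} k K)
    (hexp : ∃ P ∈ E.sing, E.HasEqualLocalExponents P) (Φ : K) (hΦ : E.IsSolution Φ) (hΦ0 : Φ ≠ 0)
    (g h : K →ₐ[k] L) (hgsep : IsSeparableCover g) (hgtame : IsTameCover p g)
    (hgbr : IsUnbranchedOutside g E.sing) (hhbr : IsUnbranchedOutside h E.sing)
    (hadapted : E.IsAdapted g h)
    (ha : (E.pullback g).sing = Place.preimage g E.sing ∧
      (E.pullback g).sing = Place.preimage h E.sing) :
    ∀ Q ∈ E.splitSet p g Φ, ∀ P, Place.LiesOver g P Q →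
      ∀ Q' n, Place.HasRamificationIdx h P Q' n → n = 1 ∧ Q' ∈ E.splitSet p g Φ := by
  rintro Q ⟨hQord, hQsing⟩ P ⟨m, hm⟩ Q' n hn
  have hP : P ∉ E.sing := fun hP => hQsing (ha.1 ▸ ⟨P, hP, m, hm⟩)
  obtain rfl := hgbr P Q m hm hP
  obtain rfl := hhbr P Q' n hn hP
  have hQ'sing : Q' ∉ (E.pullback g).sing := fun hQ' => by
    rw [ha.2] at hQ'
    obtain ⟨P', hP', hPQ'⟩ := hQ'
    exact hP (Place.LiesOver.unique hPQ' ⟨1, hn⟩ ▸ hP')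
  refine ⟨rfl, ?_, hQ'sing⟩
  obtain ⟨P₀, -, hP₀⟩ := hexp
  obtain ⟨Q₀, hQ₀⟩ : ∃ Q₀, Place.LiesOver g P₀ Q₀ := by
    let _ : Algebra K L := g.toRingHom.toAlgebra
    have : IsScalarTower k K L := IsScalarTower.of_algebraMap_eq fun c => (g.commutes c).symm
    have : Algebra.IsSeparable K L := hgsep.algebra_isSeparable
    have : FiniteDimensional K L := hgsep.algebra_finite hL
    obtain ⟨⟨Q₀, hQ₀⟩⟩ := (Nat.card_pos_iff.1 (Place.placesOver (F' := L) P₀).2.2.1).1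
    exact ⟨Q₀, hQ₀⟩
  rw [hadapted.dvd_ord_iff p hL hgsep hgtame hP₀ hQ₀ hΦ hΦ0 hQ'sing, hn.ord_eq hΦ0]
  rwa [hm.ord_eq hΦ0] at hQord

end Adapted

end SplittingTower

end

theorem mainTheorem10
    {k : Type*} [Field k] [Finite k] (p : ℕ) [Fact p.Prime] [CharP k p]
    {K L : Type*} [Field K] [Algebra k K] [Field L] [Algebra k L]
    -- `X_{-1}` and `X_0`
    (hK : SplittingTower.IsCurve k K) (hL : SplittingTower.IsCurve k L)
    -- the Fuchsian differential equation of rank two on `X_{-1}` and its algebraic solution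
    (E : SplittingTower.DiffEq k K) (hcyc : E.IsCyclicOfRankTwo) (hfuchs : E.IsFuchsian)
    (hexp : ∃ P ∈ E.sing, E.HasEqualLocalExponents P)
    (Φ : K) (hΦ : E.IsSolution Φ) (hΦ0 : Φ ≠ 0)
    -- the tame correspondence adapted to it, unbranched outside the singularities
    (g h : K →ₐ[k] L)
    (hgsep : SplittingTower.IsSeparableCover g) (hhsep : SplittingTower.IsSeparableCover h)
    (hgtame : SplittingTower.IsTameCover p g) (hhtame : SplittingTower.IsTameCover p h)
    (hgbr : SplittingTower.IsUnbranchedOutside g E.sing)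
    (hhbr : SplittingTower.IsUnbranchedOutside h E.sing)
    (hadapted : E.IsAdapted g h)
    -- assumptions (a), (b), (c)
    (ha : (E.pullback g).sing = SplittingTower.Place.preimage g E.sing ∧
      (E.pullback g).sing = SplittingTower.Place.preimage h E.sing)
    (hb : ∀ m : ℕ, SplittingTower.GeomIntegral k (SplittingTower.tower g h m).ring)
    (δ : ℕ) (hc : SplittingTower.coverDegree g = δ ∧ SplittingTower.coverDegree h = δ)
    -- all points of `𝔗` are rational over the constant field
    (hrat : ∀ Q ∈ E.splitSet p g Φ, Q.IsRational) :
    (∀ Q ∈ E.splitSet p g Φ, ∀ (m : ℕ)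
      (R : SplittingTower.Place k (SplittingTower.tower g h m).ring) (n : ℕ),
        SplittingTower.Place.HasRamificationIdx (SplittingTower.tower g h m).first Q R n →
          n = 1 ∧ R.IsRational) ∧
    (E.splitSet p g Φ).Finite ∧
    ∃ ν : ℝ,
      Filter.Tendsto
        (fun m : ℕ => (SplittingTower.numRationalPoints k (SplittingTower.tower g h m).ring : ℝ)
          / (δ : ℝ) ^ m)
        Filter.atTop (nhds ν) ∧
      ((E.splitSet p g Φ).ncard : ℝ) ≤ ν := by

  have hT : ∀ Q ∈ E.splitSet p g Φ, ∀ P, SplittingTower.Place.LiesOver g P Q →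
      ∀ Q' n, SplittingTower.Place.HasRamificationIdx h P Q' n →
        n = 1 ∧ Q'.IsRational ∧ Q' ∈ E.splitSet p g Φ := fun Q hQ P hP Q' n hn => by
    obtain ⟨h1, h2⟩ := E.splitSet_closed p hL hexp Φ hΦ hΦ0 g h hgsep hgtame hgbr hhbr hadapted ha
      Q hQ P hP Q' n hn
    exact ⟨h1, hrat Q' h2, h2⟩
  have hfinrat := hL.finite_rational
  have hTfin : (E.splitSet p g Φ).Finite :=
    Set.Finite.subset (s := {Q : SplittingTower.Place k L | Q.IsRational}) hfinrat hrat
  have hspec := SplittingTower.tower_spec g h hgsep hhsep hL hb hTfin hrat hT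
  have hδ : 0 < δ := by
    rw [← hc.2, SplittingTower.coverDegree_eq_finrank]
    let _ : Algebra K L := h.toRingHom.toAlgebra
    have : FiniteDimensional K L := hhsep.algebra_finite hL
    exact Module.finrank_pos
  have hδ' : (0 : ℝ) < δ := by exact_mod_cast hδ
  rw [hc.2] at hspec
  refine ⟨fun Q hQ m R n hn => ?_, hTfin, ?_⟩
  · obtain ⟨h1, h2, -⟩ := (hspec m).2.2.1.unramified Q hQ R ⟨n, hn⟩
    exact ⟨hn.unique h1, h2⟩
  · set N : ℕ → ℝ := fun m =>
      (SplittingTower.numRationalPoints k (SplittingTower.tower g h m).ring : ℝ) / (δ : ℝ) ^ m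
    have hanti : Antitone N := antitone_nat_of_succ_le fun m => by
      have h1 : (SplittingTower.numRationalPoints k (SplittingTower.tower g h (m + 1)).ring : ℝ) ≤
          δ * SplittingTower.numRationalPoints k (SplittingTower.tower g h m).ring := by
        exact_mod_cast (hspec m).2.2.2
      simp only [N]
      rw [div_le_div_iff₀ (by positivity) (by positivity), pow_succ]
      nlinarith [pow_pos hδ' m]
    have hlow : ∀ m, ((E.splitSet p g Φ).ncard : ℝ) ≤ N m := fun m => by
      have h1 := (hspec m).2.2.1
      have h2 : δ ^ m * (E.splitSet p g Φ).ncard ≤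
          SplittingTower.numRationalPoints k (SplittingTower.tower g h m).ring := by
        have h3 : {R | ∃ Q ∈ E.splitSet p g Φ,
            SplittingTower.Place.LiesOver (SplittingTower.tower g h m).first Q R} ⊆
            {R | R.IsRational} := by
          rintro R ⟨Q, hQ, hQR⟩
          exact (h1.unramified Q hQ R hQR).2.1
        rw [← h1.ncard]
        exact Set.ncard_le_ncard h3 (hspec m).2.1
      simp only [N]
      rw [le_div_iff₀ (by positivity), mul_comm]
      exact_mod_cast h2
    exact ⟨_, tendsto_atTop_ciInf hanti ⟨_, Set.forall_mem_range.2 hlow⟩, le_ciInf hlow⟩
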